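/- Let $n$ be a natural number. A marked metric graph of rank $n$ is a finite connected graph $A$, all of whose vertices have valence at least three, with a positive length on every edge and a marking, i.e. a homotopy equivalence $\tau_A\colon R_n\to A$ from the rose $R_n$ with $n$ petals (equivalently, up to homotopy, an isomorphism of the free group $F_n=\pi_1(R_n)$ onto the fundamental group of $A$ at a base vertex). Two marked metric graphs $A,B$ are equivalent if there is a homothety $h\colon A\to B$ such that $h\circ\tau_A$ is freely homotopic to $\tau_B$; the set of equivalence classes is $CV_n$. For $w\in F_n$ let $l_A(w)$ be the length of a shortest loop in the free homotopy class of loops in $A$ determined by the conjugacy class of $w$. Put $$\Lambda_R(A,B)=\sup_{1\neq w\in F_n}\frac{l_B(w)}{l_A(w)}.$$ Each class in $CV_n$ has a representative $\bar A$ of total edge length one, and for $A,B\in CV_n$ put $d_R(A,B)=\log\Lambda_R(\bar A,\bar B)$, which depends only on the classes of $A$ and $B$. **Theorem.** The function $d_R$ defines a non-symmetric metric (a metric except that symmetry is not required) on $CV_n$. That is, $l_A(w)>0$ for all marked metric graphs $A$ and all $w\ne 1$, the supremum $\Lambda_R(A,B)$ is finite for all $A,B$, and for all $A,B,C\in CV_n$: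 1. $d_R(A,B)\ge 0$; 2. $d_R(A,B)=0$ if and only if $A=B$ in $CV_n$; 3. $d_R(A,C)\le d_R(A,B)+d_R(B,C)$. -/

import Mathlib

noncomputable section

namespace OuterSpace

/-- A finite graph in the sense of Serre: a type `V` of vertices and a type `D` of oriented edges
(each geometric edge carries its two orientations `d` and `rev d`, which are distinct). Loops and
multiple edges are allowed. -/
structure Graph where
  V : Type
  D : Type
  [finiteV : Finite V]
  [fintypeD : Fintype D]
  src : D → V
  rev : D → D
  rev_rev : ∀ d, rev (rev d) = d
  rev_ne : ∀ d, rev d ≠ d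

attribute [instance] Graph.finiteV Graph.fintypeD

namespace Graph

variable (G : Graph)

/-- The terminal vertex of an oriented edge. -/
def tgt (d : G.D) : G.V := G.src (G.rev d)

/-- `G.IsPath u p v`: the list `p` of oriented edges is an edge path from `u` to `v`. -/
def IsPath : G.V → List G.D → G.V → Prop
  | u, [], v => u = v
  | u, d :: p, v => G.src d = u ∧ IsPath (G.tgt d) p v

/-- The reversed edge path. -/
def revPath (p : List G.D) : List G.D := (p.map G.rev).reverse

/-- `q` is obtained from `p` by deleting one backtracking `d, rev d`. -/
inductive Step : List G.D → List G.D → Prop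
  | cancel (p q : List G.D) (d : G.D) : Step (p ++ d :: G.rev d :: q) (p ++ q)

/-- Closed edge paths based at `v`. -/
def Loop (v : G.V) : Type := {p : List G.D // G.IsPath v p v}

/-- The (edge-path) fundamental group at `v`: closed edge paths based at `v` up to the equivalence
relation generated by insertion and deletion of backtrackings. -/
def Pi1 (v : G.V) : Type := Quot fun p q : G.Loop v => G.Step p.1 q.1

variable {G}

theorem tgt_rev (d : G.D) : G.tgt (G.rev d) = G.src d := by
  simp [tgt, G.rev_rev]

theorem isPath_append {u w : G.V} {p q : List G.D} :
    G.IsPath u (p ++ q) w ↔ ∃ v, G.IsPath u p v ∧ G.IsPath v q w := by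
  induction p generalizing u with
  | nil => simp [IsPath]
  | cons d p ih =>
    simp only [List.cons_append, IsPath, ih]
    constructor
    · rintro ⟨h, v, h1, h2⟩
      exact ⟨v, ⟨h, h1⟩, h2⟩
    · rintro ⟨v, ⟨h, h1⟩, h2⟩
      exact ⟨h, v, h1, h2⟩

theorem IsPath.append {u v w : G.V} {p q : List G.D} (hp : G.IsPath u p v)
    (hq : G.IsPath v q w) : G.IsPath u (p ++ q) w := isPath_append.2 ⟨v, hp, hq⟩

theorem revPath_cons (d : G.D) (p : List G.D) :
    G.revPath (d :: p) = G.revPath p ++ [G.rev d] := by simp [revPath]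

theorem revPath_append (p q : List G.D) :
    G.revPath (p ++ q) = G.revPath q ++ G.revPath p := by simp [revPath]

theorem revPath_revPath (p : List G.D) : G.revPath (G.revPath p) = p := by
  simp [revPath, Function.comp_def, G.rev_rev]

theorem IsPath.revPath {u v : G.V} {p : List G.D} (hp : G.IsPath u p v) :
    G.IsPath v (G.revPath p) u := by
  induction p generalizing u with
  | nil => exact Eq.symm hp
  | cons d p ih =>
    rw [revPath_cons]
    exact (ih hp.2).append ⟨rfl, (tgt_rev d).trans hp.1⟩

theorem Step.append_left {p q : List G.D} (h : G.Step p q) (r : List G.D) :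
    G.Step (r ++ p) (r ++ q) := by
  obtain ⟨a, b, d⟩ := h
  simpa [List.append_assoc] using Step.cancel (r ++ a) b d

theorem Step.append_right {p q : List G.D} (h : G.Step p q) (r : List G.D) :
    G.Step (p ++ r) (q ++ r) := by
  obtain ⟨a, b, d⟩ := h
  simpa [List.append_assoc] using Step.cancel a (b ++ r) d

theorem Step.revPath {p q : List G.D} (h : G.Step p q) :
    G.Step (G.revPath p) (G.revPath q) := by
  obtain ⟨a, b, d⟩ := h
  have := Step.cancel (G.revPath b) (G.revPath a) d
  simpa [revPath_append, revPath_cons, G.rev_rev] using this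

/-- The homotopy class of a closed edge path. -/
def Pi1.mk {v : G.V} (p : List G.D) (hp : G.IsPath v p v) : G.Pi1 v :=
  Quot.mk _ ⟨p, hp⟩

/-- Concatenation of homotopy classes. -/
def Pi1.mul {v : G.V} : G.Pi1 v → G.Pi1 v → G.Pi1 v :=
  Quot.map₂ (fun p q => ⟨p.1 ++ q.1, p.2.append q.2⟩)
    (fun p _ _ h => h.append_left p.1) (fun _ _ q h => h.append_right q.1)

/-- Reversal of homotopy classes. -/
def Pi1.inv {v : G.V} : G.Pi1 v → G.Pi1 v :=
  Quot.map (fun p => ⟨G.revPath p.1, p.2.revPath⟩) (fun _ _ h => h.revPath)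

theorem Pi1.mk_step {v : G.V} {p q : List G.D} (hp : G.IsPath v p v) (hq : G.IsPath v q v)
    (h : G.Step p q) : Pi1.mk p hp = Pi1.mk q hq := Quot.sound h

/-- A subpath followed by its reverse can be removed without changing the class. -/
theorem Pi1.mk_cancel {v : G.V} (a b p : List G.D) (h : G.IsPath v (a ++ (p ++ G.revPath p) ++ b) v)
    (h' : G.IsPath v (a ++ b) v) : Pi1.mk _ h = Pi1.mk _ h' := by
  induction p generalizing a b with
  | nil => simp [revPath]
  | cons d p ih =>
    have e : a ++ (d :: p ++ G.revPath (d :: p)) ++ b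
        = (a ++ [d]) ++ (p ++ G.revPath p) ++ (G.rev d :: b) := by
      simp [revPath_cons]
    have h2 : G.IsPath v (a ++ [d] ++ (G.rev d :: b)) v := by
      rw [isPath_append] at h'
      obtain ⟨u, ha, hb⟩ := h'
      rw [e, List.append_assoc, List.append_assoc, isPath_append] at h
      obtain ⟨u', ha', hd, -⟩ := h
      have hu : u = u' := by
        clear e ih hb hd
        induction a generalizing v with
        | nil => exact ha.symm.trans ha'
        | cons x a iha => exact iha ha.2 ha'.2
      subst hu
      refine (ha.append (q := [d]) ⟨hd, rfl⟩).append ⟨rfl, ?_⟩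
      rw [tgt_rev, hd]
      exact hb
    have h1 : G.IsPath v ((a ++ [d]) ++ (p ++ G.revPath p) ++ (G.rev d :: b)) v := e ▸ h
    have s1 : Pi1.mk _ h = Pi1.mk _ h1 := by congr 1
    rw [s1, ih _ _ h1 h2]
    refine Pi1.mk_step h2 h' ?_
    simpa using Step.cancel a b d

instance (v : G.V) : Group (G.Pi1 v) where
  mul := Pi1.mul
  one := Pi1.mk [] rfl
  inv := Pi1.inv
  mul_assoc := by
    rintro ⟨a⟩ ⟨b⟩ ⟨c⟩
    exact congrArg (Quot.mk _) (Subtype.ext (List.append_assoc _ _ _))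
  one_mul := by
    rintro ⟨a⟩
    rfl
  mul_one := by
    rintro ⟨a⟩
    exact congrArg (Quot.mk _) (Subtype.ext (List.append_nil _))
  inv_mul_cancel := by
    rintro ⟨a⟩
    have h := a.2.revPath.append a.2
    refine Eq.trans ?_ (Pi1.mk_cancel (v := v) [] [] (G.revPath a.1)
      (by simpa [revPath_revPath] using h) rfl)
    exact congrArg (Quot.mk _) (Subtype.ext (by simp [revPath_revPath]))

theorem Pi1.mk_mul {v : G.V} {p q : List G.D} (hp : G.IsPath v p v) (hq : G.IsPath v q v) :
    Pi1.mk p hp * Pi1.mk q hq = Pi1.mk (p ++ q) (hp.append hq) := rfl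

theorem Pi1.mk_inv {v : G.V} {p : List G.D} (hp : G.IsPath v p v) :
    (Pi1.mk p hp)⁻¹ = Pi1.mk (G.revPath p) hp.revPath := rfl

end Graph

/-- A marked metric graph of rank `n` (a point of the unprojectivised outer space): a finite
connected graph in which every vertex has valence at least three, a positive length for every
edge, and a marking. A homotopy equivalence from the rose with `n` petals to a graph is, up to
homotopy, the same as a base vertex together with an isomorphism from the free group of rank `n`
(the fundamental group of the rose) onto the fundamental group of the graph at that vertex. -/
structure MarkedMetricGraph (n : ℕ) extends Graph where
  connected : ∀ u v : V, ∃ p, toGraph.IsPath u p v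
  three_le_valence : ∀ v : V, 3 ≤ Nat.card {d : D // src d = v}
  len : D → ℝ
  len_pos : ∀ d, 0 < len d
  len_rev : ∀ d, len (rev d) = len d
  base : V
  marking : FreeGroup (Fin n) ≃* toGraph.Pi1 base

namespace MarkedMetricGraph

variable {n : ℕ}

/-- The closed edge path `p` at the base vertex represents the image of `w` under the marking. -/
def Represents (A : MarkedMetricGraph n) (w : FreeGroup (Fin n)) (p : List A.D) : Prop :=
  ∃ h : A.IsPath A.base p A.base, A.marking w = Graph.Pi1.mk p h

/-- The length of an edge path. -/
def pathLength (A : MarkedMetricGraph n) (p : List A.D) : ℝ := (p.map A.len).sum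

/-- The translation length `l_A(w)`: the length of a shortest loop in the free homotopy class of
loops determined by the conjugacy class of `w`. A closed edge path `c` at a vertex `u` is in this
class if and only if, for some edge path `p` from the base vertex to `u`, the closed path
`p c p⁻¹` represents `w`. -/
def translationLength (A : MarkedMetricGraph n) (w : FreeGroup (Fin n)) : ℝ :=
  sInf {r : ℝ | ∃ (u : A.V) (p c : List A.D), A.IsPath A.base p u ∧ A.IsPath u c u ∧
    A.Represents w (p ++ c ++ A.revPath p) ∧ r = A.pathLength c}

/-- The total length of all edges (each edge has two orientations). -/
def volume (A : MarkedMetricGraph n) : ℝ := (∑ d, A.len d) / 2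

/-- The set of all ratios `l_B(w) / l_A(w)` with `w ≠ 1`. -/
def ratios (A B : MarkedMetricGraph n) : Set ℝ :=
  {r : ℝ | ∃ w : FreeGroup (Fin n), w ≠ 1 ∧ r = B.translationLength w / A.translationLength w}

/-- The right hand factor `Λ_R(A, B) = sup_{w ≠ 1} l_B(w) / l_A(w)`. -/
def rightFactor (A B : MarkedMetricGraph n) : ℝ := sSup (ratios A B)

/-- The same marked graph with all edge lengths multiplied by `c > 0`. -/
def scale (A : MarkedMetricGraph n) (c : ℝ) (hc : 0 < c) : MarkedMetricGraph n where
  toGraph := A.toGraph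
  connected := A.connected
  three_le_valence := A.three_le_valence
  len d := c * A.len d
  len_pos d := mul_pos hc (A.len_pos d)
  len_rev d := by rw [A.len_rev]
  base := A.base
  marking := A.marking

theorem nonempty_D (A : MarkedMetricGraph n) : Nonempty A.D := by
  have h := A.three_le_valence A.base
  by_contra hD
  rw [not_nonempty_iff] at hD
  simp at h

theorem volume_pos (A : MarkedMetricGraph n) : 0 < A.volume := by
  have := A.nonempty_D
  exact div_pos (Finset.sum_pos (fun d _ => A.len_pos d) Finset.univ_nonempty) two_pos

/-- The volume-one representative of `A`, that is, `A` rescaled to have volume one. -/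
def normalize (A : MarkedMetricGraph n) : MarkedMetricGraph n :=
  A.scale A.volume⁻¹ (inv_pos.2 A.volume_pos)

theorem volume_normalize (A : MarkedMetricGraph n) : A.normalize.volume = 1 := by
  have h : A.normalize.volume = A.volume⁻¹ * A.volume := by
    simp only [normalize, scale, volume, ← Finset.mul_sum, mul_div_assoc]
    rfl
  rw [h, inv_mul_cancel₀ A.volume_pos.ne']

/-- A homothety between metric graphs all of whose vertices have valence at least three:
an isomorphism of graphs that multiplies the lengths of all edges by one positive constant. -/
structure Homothety (A B : MarkedMetricGraph n) where
  onV : A.V ≃ B.V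
  onD : A.D ≃ B.D
  src_map : ∀ d, B.src (onD d) = onV (A.src d)
  rev_map : ∀ d, B.rev (onD d) = onD (A.rev d)
  ratio : ℝ
  ratio_pos : 0 < ratio
  len_map : ∀ d, B.len (onD d) = ratio * A.len d

/-- The homothety `h` commutes with the markings up to free homotopy: for some edge path `p` from
the base vertex of `B` to the image of the base vertex of `A`, the isomorphism of fundamental
groups induced by `h` and by the change of base point along `p` carries the marking of `A` to
that of `B`. -/
def Homothety.Compatible {A B : MarkedMetricGraph n} (h : Homothety A B) : Prop :=
  ∃ p : List B.D, B.IsPath B.base p (h.onV A.base) ∧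
    ∀ (w : FreeGroup (Fin n)) (c : List A.D), A.Represents w c →
      B.Represents w (p ++ c.map h.onD ++ B.revPath p)

/-- Two marked metric graphs are equivalent if there is a homothety between them that commutes
with the markings up to free homotopy. -/
def Equivalent (A B : MarkedMetricGraph n) : Prop := ∃ h : Homothety A B, h.Compatible

/-! Equivalence of marked metric graphs is an equivalence relation. -/

theorem exists_represents (A : MarkedMetricGraph n) (w : FreeGroup (Fin n)) :
    ∃ c, A.Represents w c := by
  obtain ⟨c, hc⟩ := Quot.exists_rep (A.marking w)
  exact ⟨c.1, c.2, hc.symm⟩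

namespace Homothety

variable {A B C : MarkedMetricGraph n}

/-- The identity. -/
def refl (A : MarkedMetricGraph n) : Homothety A A where
  onV := Equiv.refl _
  onD := Equiv.refl _
  src_map _ := rfl
  rev_map _ := rfl
  ratio := 1
  ratio_pos := one_pos
  len_map _ := (one_mul _).symm

/-- The inverse homothety. -/
def symm (h : Homothety A B) : Homothety B A where
  onV := h.onV.symm
  onD := h.onD.symm
  src_map d := by
    rw [Equiv.eq_symm_apply, ← h.src_map, Equiv.apply_symm_apply]
  rev_map d := by
    rw [Equiv.eq_symm_apply, ← h.rev_map, Equiv.apply_symm_apply]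
  ratio := h.ratio⁻¹
  ratio_pos := inv_pos.2 h.ratio_pos
  len_map d := by
    have := h.len_map (h.onD.symm d)
    rw [Equiv.apply_symm_apply] at this
    rw [this, inv_mul_cancel_left₀ h.ratio_pos.ne']

/-- The composite homothety. -/
def trans (h : Homothety A B) (k : Homothety B C) : Homothety A C where
  onV := h.onV.trans k.onV
  onD := h.onD.trans k.onD
  src_map d := by simp [k.src_map, h.src_map]
  rev_map d := by simp [k.rev_map, h.rev_map]
  ratio := k.ratio * h.ratio
  ratio_pos := mul_pos k.ratio_pos h.ratio_pos
  len_map d := by simp [k.len_map, h.len_map, mul_assoc]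

theorem tgt_map (h : Homothety A B) (d : A.D) : B.tgt (h.onD d) = h.onV (A.tgt d) := by
  simp [Graph.tgt, h.rev_map, h.src_map]

theorem isPath_map (h : Homothety A B) {u v : A.V} {p : List A.D} (hp : A.IsPath u p v) :
    B.IsPath (h.onV u) (p.map h.onD) (h.onV v) := by
  induction p generalizing u with
  | nil => exact congrArg h.onV hp
  | cons d p ih =>
    refine ⟨(h.src_map d).trans (congrArg h.onV hp.1), ?_⟩
    rw [h.tgt_map]
    exact ih hp.2

theorem map_revPath (h : Homothety A B) (p : List A.D) :
    (A.revPath p).map h.onD = B.revPath (p.map h.onD) := by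
  simp [Graph.revPath, Function.comp_def, h.rev_map]

theorem step_map (h : Homothety A B) {p q : List A.D} (hs : A.Step p q) :
    B.Step (p.map h.onD) (q.map h.onD) := by
  obtain ⟨a, b, d⟩ := hs
  simpa [h.rev_map] using Graph.Step.cancel (G := B.toGraph) (a.map h.onD) (b.map h.onD) (h.onD d)

theorem isPath_transport (h : Homothety A B) {u : A.V} {v : B.V} {p : List B.D}
    (hp : B.IsPath v p (h.onV u)) {c : List A.D} (hc : A.IsPath u c u) :
    B.IsPath v (p ++ c.map h.onD ++ B.revPath p) v :=
  (hp.append (h.isPath_map hc)).append hp.revPath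

theorem mk_transport (h : Homothety A B) {u : A.V} {v : B.V} {p : List B.D}
    (hp : B.IsPath v p (h.onV u)) {c c' : List A.D} (hc : A.IsPath u c u) (hc' : A.IsPath u c' u)
    (e : Graph.Pi1.mk c hc = Graph.Pi1.mk c' hc') :
    Graph.Pi1.mk _ (h.isPath_transport hp hc) = Graph.Pi1.mk _ (h.isPath_transport hp hc') := by
  let f : A.Pi1 u → B.Pi1 v :=
    Quot.map (fun c : A.Loop u => ⟨_, h.isPath_transport hp c.2⟩)
      (fun _ _ hs => ((h.step_map hs).append_left p).append_right _)
  exact congrArg f e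

theorem refl_compatible (A : MarkedMetricGraph n) : (refl A).Compatible :=
  ⟨[], rfl, fun w c hc => by simpa [refl, Graph.revPath] using hc⟩

theorem Compatible.symm {h : Homothety A B} (hh : h.Compatible) : h.symm.Compatible := by
  obtain ⟨p, hp, hm⟩ := hh
  have hp' : A.IsPath A.base ((B.revPath p).map h.symm.onD) (h.symm.onV B.base) := by
    have := h.symm.isPath_map hp.revPath
    rwa [show h.symm.onV (h.onV A.base) = A.base from h.onV.symm_apply_apply _] at this
  refine ⟨_, hp', fun w c' hc' => ?_⟩
  obtain ⟨c, hc⟩ := A.exists_represents w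
  obtain ⟨hb, eb⟩ := hm w c hc
  obtain ⟨hb', eb'⟩ := hc'
  obtain ⟨ha, ea⟩ := hc
  refine ⟨h.symm.isPath_transport hp' hb', ?_⟩
  rw [h.symm.mk_transport hp' hb' hb (eb'.symm.trans eb), ea]
  have hid : (c.map h.onD).map h.symm.onD = c := by
    rw [List.map_map]
    exact List.map_id'' (fun d => h.onD.symm_apply_apply d) c
  set q := (B.revPath p).map h.symm.onD with hq
  have hpq : p.map h.symm.onD = A.revPath q := by
    rw [hq, h.symm.map_revPath, Graph.revPath_revPath]
  have hrr : (B.revPath p).map h.symm.onD = q := rfl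
  have e : q ++ (p ++ c.map h.onD ++ B.revPath p).map h.symm.onD ++ A.revPath q
      = [] ++ (q ++ A.revPath q) ++ (c ++ (q ++ A.revPath q) ++ []) := by
    rw [List.map_append, List.map_append, hid, hpq, hrr]
    simp
  have hqq := hp'.append hp'.revPath
  have h1 : A.IsPath A.base (c ++ []) A.base := by simpa using ha
  have h2 : A.IsPath A.base (c ++ (q ++ A.revPath q) ++ []) A.base := by
    simpa using ha.append hqq
  have h3 : A.IsPath A.base ([] ++ (q ++ A.revPath q) ++ (c ++ (q ++ A.revPath q) ++ [])) A.base :=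
    hqq.append h2
  have s1 : Graph.Pi1.mk c ha = Graph.Pi1.mk (c ++ []) h1 := by
    congr 1
    simp
  rw [s1, ← Graph.Pi1.mk_cancel c [] q h2 h1]
  refine (Graph.Pi1.mk_cancel [] _ q h3 h2).symm.trans ?_
  congr 1
  exact e.symm

theorem Compatible.trans {h : Homothety A B} {k : Homothety B C} (hh : h.Compatible)
    (hk : k.Compatible) : (h.trans k).Compatible := by
  obtain ⟨p, hp, hm⟩ := hh
  obtain ⟨q, hq, hm'⟩ := hk
  refine ⟨q ++ p.map k.onD, hq.append (k.isPath_map hp), fun w c hc => ?_⟩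
  have := hm' w _ (hm w c hc)
  have e : ⇑(h.trans k).onD = k.onD ∘ h.onD := rfl
  simpa [k.map_revPath, Graph.revPath_append, e] using this

/-- A homothety that commutes with the markings multiplies translation lengths by its ratio. -/
theorem Compatible.mul_mem {h : Homothety A B} (hh : h.Compatible) (w : FreeGroup (Fin n)) {r : ℝ}
    (hr : ∃ (u : A.V) (p c : List A.D), A.IsPath A.base p u ∧ A.IsPath u c u ∧
      A.Represents w (p ++ c ++ A.revPath p) ∧ r = A.pathLength c) :
    ∃ (u : B.V) (p c : List B.D), B.IsPath B.base p u ∧ B.IsPath u c u ∧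
      B.Represents w (p ++ c ++ B.revPath p) ∧ h.ratio * r = B.pathLength c := by
  obtain ⟨p, hp, hm⟩ := hh
  obtain ⟨u, p₁, c, h1, h2, h3, rfl⟩ := hr
  refine ⟨h.onV u, p ++ p₁.map h.onD, c.map h.onD, hp.append (h.isPath_map h1), h.isPath_map h2,
    ?_, ?_⟩
  · have := hm w _ h3
    simpa [h.map_revPath, Graph.revPath_append] using this
  · clear h2 h3
    induction c with
    | nil => simp [pathLength]
    | cons d c ih =>
      simp only [pathLength, List.map_cons, List.sum_cons] at ih ⊢
      rw [mul_add, ih, h.len_map]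

theorem Compatible.translationLength {h : Homothety A B} (hh : h.Compatible)
    (w : FreeGroup (Fin n)) : B.translationLength w = h.ratio * A.translationLength w := by
  unfold MarkedMetricGraph.translationLength
  rw [← smul_eq_mul, ← Real.sInf_smul_of_nonneg h.ratio_pos.le]
  congr 1
  ext r
  rw [Set.mem_smul_set]
  constructor
  · intro hr
    exact ⟨h.ratio⁻¹ * r, hh.symm.mul_mem w hr, mul_inv_cancel_left₀ h.ratio_pos.ne' r⟩
  · rintro ⟨r, hr, rfl⟩
    exact hh.mul_mem w hr

theorem volume (h : Homothety A B) : B.volume = h.ratio * A.volume := by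
  unfold MarkedMetricGraph.volume
  rw [← Equiv.sum_comp h.onD, ← mul_div_assoc, Finset.mul_sum]
  simp only [h.len_map]

/-- The identity as a homothety from `A` to `A.scale c hc`. -/
def toScale (A : MarkedMetricGraph n) (c : ℝ) (hc : 0 < c) : Homothety A (A.scale c hc) where
  onV := Equiv.refl A.V
  onD := Equiv.refl A.D
  src_map _ := rfl
  rev_map _ := rfl
  ratio := c
  ratio_pos := hc
  len_map _ := rfl

theorem toScale_compatible (A : MarkedMetricGraph n) (c : ℝ) (hc : 0 < c) :
    (toScale A c hc).Compatible :=
  ⟨[], rfl, fun w l hl => by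
    have e : [] ++ l.map (toScale A c hc).onD ++ (A.scale c hc).revPath [] = l := by
      simp only [List.nil_append]
      exact (List.append_nil _).trans (List.map_id _)
    exact e.symm ▸ hl⟩

end Homothety

theorem equivalence_equivalent (n : ℕ) : Equivalence (Equivalent (n := n)) where
  refl A := ⟨_, Homothety.refl_compatible A⟩
  symm := fun ⟨_, h⟩ => ⟨_, h.symm⟩
  trans := fun ⟨_, h⟩ ⟨_, k⟩ => ⟨_, h.trans k⟩

/-- Equivalence of marked metric graphs as a setoid. -/
instance setoid (n : ℕ) : Setoid (MarkedMetricGraph n) := ⟨Equivalent, equivalence_equivalent n⟩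

theorem normalize_equivalent (A : MarkedMetricGraph n) : Equivalent A A.normalize :=
  ⟨_, Homothety.toScale_compatible A _ _⟩

/-- Volume-one representatives of one class have the same translation lengths. -/
theorem translationLength_normalize {A B : MarkedMetricGraph n} (h : Equivalent A B) :
    A.normalize.translationLength = B.normalize.translationLength := by
  funext w
  obtain ⟨k, hk⟩ := (equivalence_equivalent n).trans
    ((equivalence_equivalent n).symm (normalize_equivalent A))
    ((equivalence_equivalent n).trans h (normalize_equivalent B))
  have hv := k.volume
  rw [volume_normalize, volume_normalize, mul_one] at hv
  rw [hk.translationLength, ← hv, one_mul]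

theorem rightFactor_normalize {A A' B B' : MarkedMetricGraph n} (hA : Equivalent A A')
    (hB : Equivalent B B') :
    rightFactor A.normalize B.normalize = rightFactor A'.normalize B'.normalize := by
  unfold rightFactor ratios
  rw [translationLength_normalize hA, translationLength_normalize hB]

end MarkedMetricGraph

open MarkedMetricGraph

/-- Culler-Vogtmann outer space of rank `n`: marked metric graphs up to homotheties that commute
with the markings up to free homotopy. -/
def CV (n : ℕ) : Type 1 := Quotient (MarkedMetricGraph.setoid n)

/-- The right hand distance `d_R(A, B) = log Λ_R(Ā, B̄)`, where `Ā` and `B̄` are the volume-one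
representatives of `A` and `B`. -/
def dR {n : ℕ} : CV n → CV n → ℝ :=
  Quotient.lift₂ (fun A B => Real.log (rightFactor A.normalize B.normalize))
    (fun _ _ _ _ hA hB => congrArg Real.log (rightFactor_normalize hA hB))

end OuterSpace

end

/-! The theorem rests on one comparison: if `l_B ≤ l_A` on the whole free group, then `B` has at
most the volume of `A`, and equal volumes make `A` and `B` equivalent
(`volume_le_of_translationLength_le`, `equivalent_of_translationLength_le`). For volume-one graphs a
factor below one would allow `A` to be shrunk without losing domination, contradicting the volume
bound; factor one is the rigid case; the triangle inequality is submultiplicativity of suprema of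
ratios. Translation lengths are positive because a nontrivial element moves every vertex of the
covering tree by at least the shortest edge, and ratios are bounded because an orbit map between
covering trees is Lipschitz.

The comparison is proved on the covering trees, where the translation length is the least
displacement of a vertex. (a) Domination gives an equivariant map `f` from the vertices of the tree
of `A` to the tree of `B` that does not increase distances. Up to a finite set of correcting factors
displacements are translation lengths, so displacements in `B` exceed those in `A` by at most a
constant (`exists_displacement_bound`). A Helly type argument removes the constant
(`exists_dist_le`), and `exists_lipschitz` places one vertex orbit at a time. (b) Compose `f` with
the projection to an edge `e` of the tree of `B`. This real function has total variation at least
the length of `e`, since orbits reach both sides of `e`; conversely the variations along one edge of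
`A`, summed over all `e`, are at most its length. Summing over orbits and exchanging the sums by
invariance gives the volume inequality (`TreeMap.volume_le`). (c) With equal volumes all these
inequalities are equalities. Then `f` preserves the length of each edge and folds no two edges at a
vertex, so it is isometric (`TreeMap.dist_eq`). Valence at least three makes vertices correspond to
vertices (`TreeMap.exists_equiv`), and the equivariant isometry descends to the graphs
(`equivalent_of_isometry`). -/

noncomputable section

namespace OuterSpace

/-! ### Free reduction of edge paths and normal forms in the fundamental group -/

namespace Graph

variable {G : Graph}

/-- An edge path without backtracking. -/
def Reduced (p : List G.D) : Prop := p.IsChain fun a b => b ≠ G.rev a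

open scoped Classical in
/-- Prepend an edge to a path, cancelling a backtracking that arises. -/
def rcons (d : G.D) : List G.D → List G.D
  | [] => [d]
  | e :: p => if e = G.rev d then p else d :: e :: p

/-- The reduced path homotopic to a given path. -/
def red (p : List G.D) : List G.D := p.foldr rcons []

open scoped Classical in
theorem rcons_cons (d e : G.D) (p : List G.D) :
    rcons d (e :: p) = if e = G.rev d then p else d :: e :: p := rfl

theorem reduced_nil : Reduced ([] : List G.D) := List.isChain_nil

theorem reduced_singleton (d : G.D) : Reduced [d] := List.isChain_singleton d

theorem reduced_cons_cons {d e : G.D} {p : List G.D} :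
    Reduced (d :: e :: p) ↔ e ≠ G.rev d ∧ Reduced (e :: p) := List.isChain_cons_cons

theorem Reduced.tail {d : G.D} {p : List G.D} (h : Reduced (d :: p)) : Reduced p :=
  List.IsChain.tail h

theorem Reduced.left {p q : List G.D} (h : Reduced (p ++ q)) : Reduced p :=
  (List.isChain_append.1 h).1

theorem Reduced.right {p q : List G.D} (h : Reduced (p ++ q)) : Reduced q :=
  (List.isChain_append.1 h).2.1

theorem rev_inj {d e : G.D} : G.rev d = G.rev e ↔ d = e :=
  ⟨fun h => by rw [← G.rev_rev d, h, G.rev_rev], fun h => h ▸ rfl⟩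

theorem Reduced.revPath {p : List G.D} (h : Reduced p) : Reduced (G.revPath p) := by
  unfold Reduced Graph.revPath
  rw [List.isChain_reverse, List.isChain_map]
  refine List.IsChain.imp (fun a b hab => ?_) h
  rw [G.rev_rev]
  exact fun h => hab h.symm

theorem reduced_rcons {d : G.D} {p : List G.D} (h : Reduced p) : Reduced (rcons d p) := by
  cases p with
  | nil => exact reduced_singleton d
  | cons e p =>
    rw [rcons_cons]
    split_ifs with he
    · exact h.tail
    · exact reduced_cons_cons.2 ⟨he, h⟩

theorem rcons_of_reduced {d : G.D} {p : List G.D} (h : Reduced (d :: p)) :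
    rcons d p = d :: p := by
  cases p with
  | nil => rfl
  | cons e p => exact if_neg (reduced_cons_cons.1 h).1

/-- The computation behind uniqueness of normal forms: each oriented edge permutes the reduced
paths, with the reversed edge as inverse, as in van der Waerden's argument for free groups. It makes
`red` invariant under `Step` without any confluence argument. -/
theorem rcons_rcons_rev {d : G.D} {p : List G.D} (h : Reduced p) :
    rcons d (rcons (G.rev d) p) = p := by
  cases p with
  | nil => simp [rcons]
  | cons e p =>
    by_cases he : e = d
    · subst he
      have : rcons (G.rev e) (e :: p) = p := if_pos (G.rev_rev e).symm
      rw [this, rcons_of_reduced h]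
    · have : rcons (G.rev d) (e :: p) = G.rev d :: e :: p := if_neg (by rwa [G.rev_rev])
      rw [this]
      exact if_pos rfl

theorem reduced_foldr {p q : List G.D} (h : Reduced q) : Reduced (p.foldr rcons q) := by
  induction p with
  | nil => exact h
  | cons d p ih => exact reduced_rcons ih

theorem reduced_red (p : List G.D) : Reduced (red p) := reduced_foldr reduced_nil

theorem red_append (p q : List G.D) : red (p ++ q) = p.foldr rcons (red q) := by
  simp [red]

theorem red_cons (d : G.D) (q : List G.D) : red (d :: q) = rcons d (red q) := rfl

theorem red_of_reduced {p : List G.D} (h : Reduced p) : red p = p := by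
  induction p with
  | nil => rfl
  | cons d p ih => rw [red_cons, ih h.tail, rcons_of_reduced h]

theorem Step.red_eq {p q : List G.D} (h : G.Step p q) : red p = red q := by
  obtain ⟨a, b, d⟩ := h
  rw [red_append, red_append, red_cons, red_cons, rcons_rcons_rev (reduced_red b)]

theorem red_steps (p : List G.D) : Relation.ReflTransGen G.Step p (red p) := by
  induction p with
  | nil => exact .refl
  | cons d p ih =>
    have h1 : Relation.ReflTransGen G.Step (d :: p) (d :: red p) :=
      Relation.ReflTransGen.lift (fun q => d :: q)
        (fun a b (h : G.Step a b) => h.append_left [d]) _ _ ih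
    refine h1.trans ?_
    rw [red_cons]
    cases h : red p with
    | nil => exact .refl
    | cons e q =>
      rw [rcons_cons]
      split_ifs with he
      · subst he
        exact .single (Step.cancel [] q d)
      · exact .refl

theorem red_eq_of_steps {p q : List G.D} (h : Relation.ReflTransGen G.Step p q) :
    red p = red q := by
  induction h with
  | refl => rfl
  | tail _ h ih => exact ih.trans h.red_eq

theorem red_append_red_left (p q : List G.D) : red (red p ++ q) = red (p ++ q) :=
  (red_eq_of_steps (Relation.ReflTransGen.lift (fun a => a ++ q)
    (fun a b (h : G.Step a b) => h.append_right q) _ _ (red_steps p))).symm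

theorem red_append_red_right (p q : List G.D) : red (p ++ red q) = red (p ++ q) := by
  rw [red_append, red_append, red_of_reduced (reduced_red q)]

theorem red_cancel (a p b : List G.D) : red (a ++ (p ++ G.revPath p) ++ b) = red (a ++ b) := by
  induction p generalizing a b with
  | nil => simp [Graph.revPath]
  | cons d p ih =>
    have := ih (a ++ [d]) (G.rev d :: b)
    have h2 : red (a ++ [d] ++ G.rev d :: b) = red (a ++ b) :=
      Step.red_eq (by simpa using Step.cancel a b d)
    rw [← h2, ← this, revPath_cons]
    simp

theorem red_left_cancel {a p q : List G.D} (h : red (a ++ p) = red (a ++ q)) :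
    red p = red q := by
  have key : ∀ s, red s = red (G.revPath a ++ red (a ++ s)) := fun s => by
    rw [red_append_red_right]
    simpa [revPath_revPath] using (red_cancel [] (G.revPath a) s).symm
  rw [key p, key q, h]

theorem red_right_cancel {a p q : List G.D} (h : red (p ++ a) = red (q ++ a)) :
    red p = red q := by
  have key : ∀ s, red s = red (red (s ++ a) ++ G.revPath a) := fun s => by
    rw [red_append_red_left]
    simpa using (red_cancel s a []).symm
  rw [key p, key q, h]

theorem IsPath.nil (u : G.V) : G.IsPath u [] u := rfl

theorem Step.isPath {p q : List G.D} (h : G.Step p q) {u v : G.V} (hp : G.IsPath u p v) :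
    G.IsPath u q v := by
  obtain ⟨a, b, d⟩ := h
  obtain ⟨x, h1, h2, h3, h4⟩ := isPath_append.1 hp
  refine h1.append ?_
  rw [tgt_rev] at h4
  exact h2 ▸ h4

theorem isPath_of_steps {p q : List G.D} (h : Relation.ReflTransGen G.Step p q) {u v : G.V}
    (hp : G.IsPath u p v) : G.IsPath u q v := by
  induction h with
  | refl => exact hp
  | tail _ h ih => exact h.isPath ih

theorem IsPath.red {u v : G.V} {p : List G.D} (hp : G.IsPath u p v) : G.IsPath u (red p) v :=
  isPath_of_steps (red_steps p) hp

theorem Pi1.mk_congr {v : G.V} {p q : List G.D} (hp : G.IsPath v p v) (hq : G.IsPath v q v)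
    (h : p = q) : Pi1.mk p hp = Pi1.mk q hq := by
  subst h
  rfl

theorem Pi1.mk_red {v : G.V} {p : List G.D} (hp : G.IsPath v p v) :
    Pi1.mk p hp = Pi1.mk (red p) hp.red := by
  have key : ∀ q (h : Relation.ReflTransGen G.Step p q),
      Pi1.mk p hp = Pi1.mk q (isPath_of_steps h hp) := fun q h => by
    induction h with
    | refl => rfl
    | tail h1 h ih => exact ih.trans (Pi1.mk_step _ _ h)
  exact key _ (red_steps p)

/-- `red` is constant on homotopy classes and `red p` is reached from `p` by cancellations, so
reduced paths are normal forms. -/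
theorem Pi1.mk_eq_iff {v : G.V} {p q : List G.D} (hp : G.IsPath v p v) (hq : G.IsPath v q v) :
    Pi1.mk p hp = Pi1.mk q hq ↔ Graph.red p = Graph.red q := by
  constructor
  · intro h
    exact congrArg (Quot.lift (fun p : G.Loop v => Graph.red p.1) fun _ _ h => h.red_eq) h
  · intro h
    rw [Pi1.mk_red, Pi1.mk_red hq]
    exact Pi1.mk_congr _ _ h

theorem IsPath.end_unique {u v v' : G.V} {p : List G.D} (h : G.IsPath u p v)
    (h' : G.IsPath u p v') : v = v' := by
  induction p generalizing u with
  | nil => exact h.symm.trans h'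
  | cons d p ih => exact ih h.2 h'.2

end Graph

/-! ### Holonomy of edge paths in the free group -/

namespace MarkedMetricGraph

open OuterSpace.Graph

variable {n : ℕ} (A : MarkedMetricGraph n)

open scoped Classical in
/-- A chosen edge path from the base vertex to a vertex. -/
def treePath (v : A.V) : List A.D :=
  if v = A.base then [] else (A.connected A.base v).choose

theorem isPath_treePath (v : A.V) : A.IsPath A.base (A.treePath v) v := by
  unfold treePath
  split_ifs with h
  · exact h.symm
  · exact (A.connected A.base v).choose_spec

theorem treePath_base : A.treePath A.base = [] := if_pos rfl

theorem isPath_conj {u v : A.V} {p : List A.D} (hp : A.IsPath u p v) :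
    A.IsPath A.base (A.treePath u ++ p ++ A.revPath (A.treePath v)) A.base :=
  ((A.isPath_treePath u).append hp).append (A.isPath_treePath v).revPath

theorem isPath_edge (d : A.D) : A.IsPath (A.src d) [d] (A.tgt d) := ⟨rfl, rfl⟩

/-- The holonomy of an oriented edge with respect to the chosen paths. -/
def hol (d : A.D) : FreeGroup (Fin n) :=
  A.marking.symm (Pi1.mk _ (A.isPath_conj (A.isPath_edge d)))

/-- The holonomy of an edge path. -/
def holPath (p : List A.D) : FreeGroup (Fin n) := (p.map A.hol).prod

@[simp] theorem holPath_nil : A.holPath [] = 1 := rfl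

@[simp] theorem holPath_cons (d : A.D) (p : List A.D) :
    A.holPath (d :: p) = A.hol d * A.holPath p := rfl

@[simp] theorem holPath_append (p q : List A.D) :
    A.holPath (p ++ q) = A.holPath p * A.holPath q := by simp [holPath]

/-- Between consecutive edges the chosen path to the intermediate vertex is run back and forth and
cancels; only the two outer connecting paths survive. -/
theorem holPath_eq {u v : A.V} {p : List A.D} (hp : A.IsPath u p v) :
    A.holPath p = A.marking.symm (Pi1.mk _ (A.isPath_conj hp)) := by
  induction p generalizing u with
  | nil =>
    obtain rfl : u = v := hp
    symm
    rw [holPath_nil, MulEquiv.map_eq_one_iff]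
    refine (Pi1.mk_eq_iff (q := []) _ (IsPath.nil A.base)).2 ?_
    simpa using red_cancel (G := A.toGraph) [] (A.treePath u) []
  | cons d p ih =>
    obtain ⟨rfl, h2⟩ := hp
    rw [holPath_cons, ih h2, hol, ← map_mul, Pi1.mk_mul]
    congr 1
    rw [Pi1.mk_eq_iff]
    have := red_cancel (G := A.toGraph) (A.treePath (A.src d) ++ [d])
      (A.revPath (A.treePath (A.tgt d))) (p ++ A.revPath (A.treePath v))
    rw [revPath_revPath] at this
    simpa using this

theorem holPath_loop {p : List A.D} (hp : A.IsPath A.base p A.base) :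
    A.holPath p = A.marking.symm (Pi1.mk p hp) := by
  rw [A.holPath_eq hp]
  congr 1
  apply Pi1.mk_congr
  simp [treePath_base, Graph.revPath]

theorem represents_iff {w : FreeGroup (Fin n)} {p : List A.D} :
    A.Represents w p ↔ A.IsPath A.base p A.base ∧ A.holPath p = w := by
  constructor
  · rintro ⟨h, e⟩
    exact ⟨h, by rw [A.holPath_loop h, ← e, MulEquiv.symm_apply_apply]⟩
  · rintro ⟨h, e⟩
    exact ⟨h, by rw [← e, A.holPath_loop h, MulEquiv.apply_symm_apply]⟩

/-- Simple connectedness of the covering graph: the connecting paths on both sides can be cancelled,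
so the holonomy and the end points determine a path up to homotopy. -/
theorem red_eq_of_holPath_eq {u v : A.V} {p q : List A.D} (hp : A.IsPath u p v)
    (hq : A.IsPath u q v) (h : A.holPath p = A.holPath q) : red p = red q := by
  rw [A.holPath_eq hp, A.holPath_eq hq] at h
  have := (Pi1.mk_eq_iff _ _).1 (A.marking.symm.injective h)
  exact red_left_cancel (red_right_cancel this)

theorem holPath_red {u v : A.V} {p : List A.D} (hp : A.IsPath u p v) :
    A.holPath (red p) = A.holPath p := by
  rw [A.holPath_eq hp, A.holPath_eq hp.red]
  congr 1
  rw [Pi1.mk_eq_iff, List.append_assoc, List.append_assoc, ← red_append_red_right,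
    red_append_red_left, red_append_red_right]

theorem holPath_revPath {u v : A.V} {p : List A.D} (hp : A.IsPath u p v) :
    A.holPath (A.revPath p) = (A.holPath p)⁻¹ := by
  rw [eq_inv_iff_mul_eq_one, ← holPath_append]
  have h := hp.revPath.append hp
  rw [← A.holPath_red h]
  have := red_cancel (G := A.toGraph) [] (A.revPath p) []
  rw [revPath_revPath] at this
  simp only [List.nil_append, List.append_nil] at this
  rw [this]
  rfl

theorem hol_rev (d : A.D) : A.hol (A.rev d) = (A.hol d)⁻¹ := by
  simpa [Graph.revPath] using A.holPath_revPath (A.isPath_edge d)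

theorem exists_reduced (u v : A.V) (w : FreeGroup (Fin n)) :
    ∃ p, Reduced p ∧ A.IsPath u p v ∧ A.holPath p = w := by
  obtain ⟨c, hc⟩ := A.exists_represents w
  obtain ⟨hc, e⟩ := A.represents_iff.1 hc
  have hu : A.holPath (A.treePath u) = 1 ∧ A.holPath (A.treePath v) = 1 := by
    have key : ∀ x, A.holPath (A.treePath x) = 1 := fun x => by
      rw [A.holPath_eq (A.isPath_treePath x), MulEquiv.map_eq_one_iff]
      refine (Pi1.mk_eq_iff (q := []) _ (IsPath.nil A.base)).2 ?_
      simpa [treePath_base] using red_cancel (G := A.toGraph) [] (A.treePath x) []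
    exact ⟨key u, key v⟩
  have h := ((A.isPath_treePath u).revPath.append hc).append (A.isPath_treePath v)
  refine ⟨_, reduced_red _, h.red, ?_⟩
  rw [A.holPath_red h, holPath_append, holPath_append, A.holPath_revPath (A.isPath_treePath u),
    hu.1, hu.2, e]
  simp

theorem reduced_unique {u v : A.V} {p q : List A.D} (hp : A.IsPath u p v)
    (hq : A.IsPath u q v) (rp : Reduced p) (rq : Reduced q) (h : A.holPath p = A.holPath q) :
    p = q := by
  rw [← red_of_reduced rp, ← red_of_reduced rq]
  exact A.red_eq_of_holPath_eq hp hq h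

end MarkedMetricGraph

/-! ### Tree metrics and the four point condition -/

/-- A tree metric: a symmetric function, zero on the diagonal, with the four point condition. -/
structure TreeMetric {X : Type*} (d : X → X → ℝ) : Prop where
  self : ∀ x, d x x = 0
  symm : ∀ x y, d x y = d y x
  four : ∀ x y z w, d x y + d z w ≤ max (d x z + d y w) (d x w + d y z)

namespace TreeMetric

variable {X : Type*} {d : X → X → ℝ}

theorem triangle (h : TreeMetric d) (x y z : X) : d x z ≤ d x y + d y z := by
  have := h.four x z y y
  rw [h.self, h.symm z y, max_self] at this
  linarith

theorem nonneg (h : TreeMetric d) (x y : X) : 0 ≤ d x y := by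
  have := h.triangle x y x
  rw [h.self, h.symm y x] at this
  linarith

/-- The distances from a point on a segment are determined by those from its end points. -/
theorem dist_between (h : TreeMetric d) {x y z : X} {a b : ℝ} (hx : d z x = a) (hy : d z y = b)
    (hxy : d x y = a + b) (w : X) : d z w = max (d x w - a) (d y w - b) := by
  apply le_antisymm
  · have := h.four z w x y
    rw [hx, hy, hxy, h.symm w x, h.symm w y] at this
    rcases le_max_iff.1 this with h1 | h1
    · exact le_max_of_le_right (by linarith)
    · exact le_max_of_le_left (by linarith)
  · have h1 := h.triangle x z w
    have h2 := h.triangle y z w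
    rw [h.symm x z] at h1
    rw [h.symm y z] at h2
    exact max_le (by linarith) (by linarith)

end TreeMetric

/-! ### Lengths of reduced paths -/

namespace MarkedMetricGraph

open OuterSpace.Graph

variable {n : ℕ} (A : MarkedMetricGraph n)

theorem pathLength_nil : A.pathLength [] = 0 := rfl

theorem pathLength_cons (d : A.D) (p : List A.D) :
    A.pathLength (d :: p) = A.len d + A.pathLength p := rfl

theorem pathLength_append (p q : List A.D) :
    A.pathLength (p ++ q) = A.pathLength p + A.pathLength q := by simp [pathLength]

theorem pathLength_revPath (p : List A.D) : A.pathLength (A.revPath p) = A.pathLength p := by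
  simp [pathLength, Graph.revPath, List.sum_reverse, Function.comp_def, A.len_rev]

theorem pathLength_nonneg (p : List A.D) : 0 ≤ A.pathLength p :=
  List.sum_nonneg fun x hx => by
    obtain ⟨d, -, rfl⟩ := List.mem_map.1 hx
    exact (A.len_pos d).le

theorem pathLength_rcons_le (d : A.D) (p : List A.D) :
    A.pathLength (rcons d p) ≤ A.len d + A.pathLength p := by
  cases p with
  | nil => rfl
  | cons e p =>
    rw [rcons_cons]
    split_ifs
    · rw [pathLength_cons]
      linarith [A.len_pos d, A.len_pos e]
    · rfl

theorem pathLength_red_le (p : List A.D) : A.pathLength (red p) ≤ A.pathLength p := by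
  induction p with
  | nil => rfl
  | cons d p ih =>
    rw [red_cons, pathLength_cons]
    linarith [A.pathLength_rcons_le d (red p)]

theorem pathLength_red_lt {p : List A.D} (hp : ¬ Reduced p) :
    A.pathLength (red p) < A.pathLength p := by
  induction p with
  | nil => exact absurd reduced_nil hp
  | cons d p ih =>
    rw [red_cons, pathLength_cons]
    by_cases h : Reduced p
    · rw [red_of_reduced h]
      cases p with
      | nil => exact absurd (reduced_singleton d) hp
      | cons e p =>
        have he : e = A.rev d := by
          by_contra he
          exact hp (reduced_cons_cons.2 ⟨he, h⟩)
        rw [rcons_cons, if_pos he, pathLength_cons]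
        linarith [A.len_pos d, A.len_pos e]
    · linarith [A.pathLength_rcons_le d (red p), ih h]

open scoped Classical in
/-- The length of the longest common initial segment of two paths. -/
def gromovProd : List A.D → List A.D → ℝ
  | d :: p, e :: q => if d = e then A.len d + gromovProd p q else 0
  | _, _ => 0

theorem gromovProd_nil_left (q : List A.D) : A.gromovProd [] q = 0 := by
  simp [gromovProd]

theorem gromovProd_nil_right (q : List A.D) : A.gromovProd q [] = 0 := by
  cases q <;> simp [gromovProd]

theorem gromovProd_cons_self (d : A.D) (p q : List A.D) :
    A.gromovProd (d :: p) (d :: q) = A.len d + A.gromovProd p q := by simp [gromovProd]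

theorem gromovProd_cons_ne {d e : A.D} (h : d ≠ e) (p q : List A.D) :
    A.gromovProd (d :: p) (e :: q) = 0 := by simp [gromovProd, h]

theorem gromovProd_nonneg (p q : List A.D) : 0 ≤ A.gromovProd p q := by
  induction p generalizing q with
  | nil => rw [gromovProd_nil_left]
  | cons d p ih =>
    cases q with
    | nil => rw [gromovProd_nil_right]
    | cons e q =>
      by_cases h : d = e
      · subst h
        rw [gromovProd_cons_self]
        linarith [ih q, A.len_pos d]
      · rw [A.gromovProd_cons_ne h]

/-- Two paths that both agree with `q` up to some length agree with each other up to that length.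
This ultrametric inequality is the source of the four point condition. -/
theorem gromovProd_min (p q r : List A.D) :
    min (A.gromovProd p q) (A.gromovProd q r) ≤ A.gromovProd p r := by
  induction p generalizing q r with
  | nil => exact min_le_of_left_le (by simp [gromovProd_nil_left])
  | cons d p ih =>
    cases q with
    | nil => exact min_le_of_left_le (by rw [gromovProd_nil_right]; exact gromovProd_nonneg _ _ _)
    | cons e q =>
      cases r with
      | nil => exact min_le_of_right_le (by simp [gromovProd_nil_right])
      | cons f r =>
        by_cases h1 : d = e
        · subst h1
          by_cases h2 : d = f
          · subst h2
            rw [gromovProd_cons_self, gromovProd_cons_self, gromovProd_cons_self,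
              min_add_add_left]
            linarith [ih q r]
          · rw [A.gromovProd_cons_ne h2, A.gromovProd_cons_ne h2]
            exact min_le_right _ _
        · rw [A.gromovProd_cons_ne h1]
          exact min_le_of_left_le (gromovProd_nonneg _ _ _)

/-- Exactly the common initial segment cancels, and it is lost from both paths. -/
theorem pathLength_red_revPath_append {p q : List A.D} (hp : Reduced p) (hq : Reduced q) :
    A.pathLength (red (A.revPath p ++ q)) =
      A.pathLength p + A.pathLength q - 2 * A.gromovProd p q := by
  induction p generalizing q with
  | nil =>
    rw [gromovProd_nil_left]
    simp [Graph.revPath, red_of_reduced hq, pathLength_nil]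
  | cons d p ih =>
    have main : Reduced (A.revPath (d :: p) ++ q) → A.gromovProd (d :: p) q = 0 →
        A.pathLength (red (A.revPath (d :: p) ++ q)) =
          A.pathLength (d :: p) + A.pathLength q - 2 * A.gromovProd (d :: p) q := fun h1 h2 => by
      rw [red_of_reduced h1, h2, pathLength_append, pathLength_revPath]
      ring
    cases q with
    | nil => exact main (by simpa using hp.revPath) (A.gromovProd_nil_right _)
    | cons e q =>
      by_cases h : d = e
      · subst h
        have : Graph.Step A.toGraph (A.revPath (d :: p) ++ d :: q) (A.revPath p ++ q) := by
          have := Step.cancel (G := A.toGraph) (A.revPath p) q (A.rev d)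
          rw [A.rev_rev] at this
          simpa [revPath_cons] using this
        rw [this.red_eq, ih hp.tail hq.tail, gromovProd_cons_self, pathLength_cons,
          pathLength_cons]
        ring
      · refine main ?_ (A.gromovProd_cons_ne h _ _)
        refine List.isChain_append.2 ⟨hp.revPath, hq, ?_⟩
        rw [revPath_cons]
        intro x hx y hy
        simp only [List.getLast?_append, List.getLast?_singleton, Option.some_or,
          Option.mem_def, Option.some.injEq, List.head?_cons] at hx hy
        subst hx hy
        rw [A.rev_rev]
        exact fun h' => h h'.symm

/-! ### The universal covering tree and its vertex metric -/

/-- The vertices of the universal covering tree. -/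
abbrev TV : Type := FreeGroup (Fin n) × A.V

/-- The oriented edges of the universal covering tree. -/
abbrev TE : Type := FreeGroup (Fin n) × A.D

variable {A}

/-- The source of an edge of the covering tree. -/
def esrc (e : A.TE) : A.TV := (e.1, A.src e.2)

/-- The target of an edge of the covering tree. -/
def etgt (e : A.TE) : A.TV := (e.1 * A.hol e.2, A.tgt e.2)

/-- The reverse of an edge of the covering tree. -/
def erev (e : A.TE) : A.TE := (e.1 * A.hol e.2, A.rev e.2)

/-- The length of an edge of the covering tree. -/
def elen (e : A.TE) : ℝ := A.len e.2

/-- The action of the free group on the vertices of the covering tree. -/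
def act (g : FreeGroup (Fin n)) (y : A.TV) : A.TV := (g * y.1, y.2)

/-- The action of the free group on the edges of the covering tree. -/
def eact (g : FreeGroup (Fin n)) (e : A.TE) : A.TE := (g * e.1, e.2)

theorem act_one (y : A.TV) : act 1 y = y := by simp [act]

theorem act_mul (g h : FreeGroup (Fin n)) (y : A.TV) : act (g * h) y = act g (act h y) := by
  simp [act, mul_assoc]

theorem esrc_eact (g : FreeGroup (Fin n)) (e : A.TE) : esrc (eact g e) = act g (esrc e) := rfl

theorem etgt_eact (g : FreeGroup (Fin n)) (e : A.TE) : etgt (eact g e) = act g (etgt e) := by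
  simp [etgt, eact, act, mul_assoc]

theorem elen_eact (g : FreeGroup (Fin n)) (e : A.TE) : elen (eact g e) = elen e := rfl

theorem elen_pos (e : A.TE) : 0 < elen e := A.len_pos _

theorem esrc_erev (e : A.TE) : esrc (erev e) = etgt e := rfl

theorem etgt_erev (e : A.TE) : etgt (erev e) = esrc e := by
  simp [etgt, erev, esrc, A.hol_rev, Graph.tgt_rev]

theorem erev_erev (e : A.TE) : erev (erev e) = e := by
  simp [erev, A.hol_rev, A.rev_rev]

theorem elen_erev (e : A.TE) : elen (erev e) = elen e := A.len_rev _

variable (A)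

/-- The edge path `p` lifts to a path from `y` to `y'` in the covering tree. -/
def Joins (y : A.TV) (p : List A.D) (y' : A.TV) : Prop :=
  A.IsPath y.2 p y'.2 ∧ y.1 * A.holPath p = y'.1

variable {A}

theorem Joins.nil (y : A.TV) : A.Joins y [] y := ⟨rfl, mul_one _⟩

theorem joins_edge (e : A.TE) : A.Joins (esrc e) [e.2] (etgt e) :=
  ⟨A.isPath_edge _, by simp [esrc, etgt]⟩

theorem Joins.append {x y z : A.TV} {p q : List A.D} (hp : A.Joins x p y) (hq : A.Joins y q z) :
    A.Joins x (p ++ q) z :=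
  ⟨hp.1.append hq.1, by rw [holPath_append, ← mul_assoc, hp.2, hq.2]⟩

theorem Joins.revPath {x y : A.TV} {p : List A.D} (hp : A.Joins x p y) :
    A.Joins y (A.revPath p) x :=
  ⟨hp.1.revPath, by rw [A.holPath_revPath hp.1, ← hp.2, mul_inv_cancel_right]⟩

theorem Joins.red {x y : A.TV} {p : List A.D} (hp : A.Joins x p y) : A.Joins x (red p) y :=
  ⟨hp.1.red, by rw [A.holPath_red hp.1, hp.2]⟩

theorem joins_append {x z : A.TV} {p q : List A.D} (h : A.Joins x (p ++ q) z) :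
    ∃ y, A.Joins x p y ∧ A.Joins y q z := by
  obtain ⟨v, h1, h2⟩ := Graph.isPath_append.1 h.1
  refine ⟨(x.1 * A.holPath p, v), ⟨h1, rfl⟩, h2, ?_⟩
  rw [mul_assoc, ← holPath_append, h.2]

theorem Joins.end_unique {x y z : A.TV} {p : List A.D} (hp : A.Joins x p y)
    (hq : A.Joins x p z) : y = z :=
  Prod.ext (hp.2.symm.trans hq.2) (hp.1.end_unique hq.1)

theorem Joins.nil_iff {x y : A.TV} : A.Joins x [] y ↔ x = y :=
  ⟨fun h => (Joins.nil x).end_unique h, fun h => h ▸ Joins.nil x⟩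

theorem Joins.cons {x z : A.TV} {d : A.D} {p : List A.D} (h : A.Joins x (d :: p) z) :
    esrc (x.1, d) = x ∧ A.Joins (etgt (x.1, d)) p z := by
  have h1 : esrc (x.1, d) = x := Prod.ext rfl h.1.1
  refine ⟨h1, ?_⟩
  obtain ⟨y, h2, h3⟩ := joins_append (p := [d]) h
  rwa [(joins_edge (x.1, d)).end_unique (h1.symm ▸ h2)]

theorem Joins.unique {x y : A.TV} {p q : List A.D} (hp : A.Joins x p y) (hq : A.Joins x q y)
    (rp : Reduced p) (rq : Reduced q) : p = q :=
  A.reduced_unique hp.1 hq.1 rp rq (mul_left_cancel (hp.2.trans hq.2.symm))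

theorem exists_joins (x y : A.TV) : ∃ p, Reduced p ∧ A.Joins x p y := by
  obtain ⟨p, h1, h2, h3⟩ := A.exists_reduced x.2 y.2 (x.1⁻¹ * y.1)
  exact ⟨p, h1, h2, by rw [h3, mul_inv_cancel_left]⟩

/-- The path metric on the vertices of the covering tree. -/
def tdist (x y : A.TV) : ℝ := A.pathLength (exists_joins x y).choose

theorem Joins.tdist_eq {x y : A.TV} {p : List A.D} (hp : A.Joins x p y) (rp : Reduced p) :
    tdist x y = A.pathLength p := by
  have h := (exists_joins x y).choose_spec
  unfold tdist
  rw [h.2.unique hp h.1 rp]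

theorem Joins.tdist_eq_red {x y : A.TV} {p : List A.D} (hp : A.Joins x p y) :
    tdist x y = A.pathLength (Graph.red p) := hp.red.tdist_eq (reduced_red p)

theorem Joins.tdist_le {x y : A.TV} {p : List A.D} (hp : A.Joins x p y) :
    tdist x y ≤ A.pathLength p := hp.tdist_eq_red.trans_le (A.pathLength_red_le p)

theorem Joins.reduced_of_le {x y : A.TV} {p : List A.D} (hp : A.Joins x p y)
    (h : A.pathLength p ≤ tdist x y) : Reduced p := by
  by_contra hr
  exact absurd (A.pathLength_red_lt hr) (not_lt.2 (hp.tdist_eq_red ▸ h))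

theorem tdist_act (g : FreeGroup (Fin n)) (x y : A.TV) :
    tdist (act g x) (act g y) = tdist x y := by
  obtain ⟨p, rp, hp⟩ := exists_joins x y
  have h : A.Joins (act g x) p (act g y) := ⟨hp.1, by
    change g * x.1 * _ = g * y.1
    rw [mul_assoc, hp.2]⟩
  rw [hp.tdist_eq rp, h.tdist_eq rp]

theorem tdist_edge (e : A.TE) : tdist (esrc e) (etgt e) = elen e := by
  rw [(joins_edge e).tdist_eq (reduced_singleton _)]
  simp [pathLength, elen]

/-- With `x` as base point, the distances among the other three points are expressed by Gromov
products of the reduced paths from `x`; the four point condition is then `gromovProd_min`. -/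
theorem treeMetric_tdist : TreeMetric (tdist (A := A)) where
  self x := (Joins.nil x).tdist_eq reduced_nil
  symm x y := by
    obtain ⟨p, rp, hp⟩ := exists_joins x y
    rw [hp.tdist_eq rp, hp.revPath.tdist_eq rp.revPath, pathLength_revPath]
  four x y z w := by
    obtain ⟨p, rp, hp⟩ := exists_joins x y
    obtain ⟨q, rq, hq⟩ := exists_joins x z
    obtain ⟨r, rr, hr⟩ := exists_joins x w
    rw [hp.tdist_eq rp, hq.tdist_eq rq, hr.tdist_eq rr, (hq.revPath.append hr).tdist_eq_red,
      (hp.revPath.append hr).tdist_eq_red, (hp.revPath.append hq).tdist_eq_red,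
      A.pathLength_red_revPath_append rp rq, A.pathLength_red_revPath_append rp rr,
      A.pathLength_red_revPath_append rq rr]
    have h := A.gromovProd_min q p r
    have hs : A.gromovProd q p = A.gromovProd p q := by
      have h1 := (hq.revPath.append hp).tdist_eq_red
      have h2 := (hp.revPath.append hq).revPath.tdist_eq_red
      rw [h1, revPath_append, revPath_revPath] at h2
      have h3 := (hp.revPath.append hq).tdist_eq_red
      have h4 := (exists_joins y z).choose_spec
      have h5 : A.pathLength (Graph.red (A.revPath q ++ p)) =
          A.pathLength (Graph.red (A.revPath p ++ q)) := by
        rw [← h3, ← h1, h4.2.tdist_eq h4.1, h4.2.revPath.tdist_eq h4.1.revPath,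
          pathLength_revPath]
      rw [A.pathLength_red_revPath_append rp rq, A.pathLength_red_revPath_append rq rp] at h5
      linarith
    rw [hs] at h
    rcases min_le_iff.1 h with h | h
    · exact le_max_of_le_right (by linarith)
    · exact le_max_of_le_left (by linarith)

theorem eq_of_tdist_eq_zero {x y : A.TV} (h : tdist x y = 0) : x = y := by
  obtain ⟨p, rp, hp⟩ := exists_joins x y
  rw [hp.tdist_eq rp] at h
  cases p with
  | nil => exact Joins.nil_iff.1 hp
  | cons d p =>
    rw [pathLength_cons] at h
    linarith [A.len_pos d, A.pathLength_nonneg p]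

variable (A) in
theorem exists_le_len : ∃ m > 0, ∀ d, m ≤ A.len d := by
  have := A.nonempty_D
  obtain ⟨d, hd⟩ := Finite.exists_min A.len
  exact ⟨A.len d, A.len_pos d, hd⟩

variable (A) in
theorem exists_len_le : ∃ m > 0, ∀ d, A.len d ≤ m := by
  have := A.nonempty_D
  obtain ⟨d, hd⟩ := Finite.exists_max A.len
  exact ⟨A.len d, A.len_pos d, hd⟩

theorem mul_length_le {m : ℝ} (hm : ∀ d, m ≤ A.len d) (p : List A.D) :
    p.length * m ≤ A.pathLength p := by
  induction p with
  | nil => simp [pathLength_nil]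
  | cons d p ih =>
    rw [pathLength_cons, List.length_cons]
    push_cast
    linarith [hm d]

theorem le_tdist {m : ℝ} (hm : ∀ d, m ≤ A.len d) {x y : A.TV} (h : x ≠ y) : m ≤ tdist x y := by
  obtain ⟨p, rp, hp⟩ := exists_joins x y
  rw [hp.tdist_eq rp]
  cases p with
  | nil => exact absurd (Joins.nil_iff.1 hp) h
  | cons d p => exact (hm d).trans (by rw [pathLength_cons]; linarith [A.pathLength_nonneg p])

/-- A vertex of the covering tree lies on one of the two sides of an edge. -/
theorem tdist_edge_cases (y : A.TV) (e : A.TE) :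
    tdist y (etgt e) = tdist y (esrc e) + elen e ∨
      tdist y (esrc e) = tdist y (etgt e) + elen e := by
  obtain ⟨p, rp, hp⟩ := exists_joins y (esrc e)
  by_cases h : Reduced (p ++ [e.2])
  · left
    rw [hp.tdist_eq rp, (hp.append (joins_edge e)).tdist_eq h, pathLength_append]
    simp [pathLength, elen]
  · right
    -- Appending the edge can only create a backtracking if the geodesic to its source ends by
    -- crossing this edge in the opposite direction.
    obtain ⟨q, rfl⟩ : ∃ q, p = q ++ [A.rev e.2] := by
      rcases List.eq_nil_or_concat p with rfl | ⟨q, d, rfl⟩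
      · exact absurd (reduced_singleton _) h
      · refine ⟨q, ?_⟩
        by_contra hne
        refine h (List.isChain_append.2 ⟨rp, reduced_singleton _, ?_⟩)
        intro a ha b hb
        simp only [List.getLast?_append, List.getLast?_singleton, Option.some_or,
          Option.mem_def, Option.some.injEq, List.head?_cons, List.concat_eq_append] at ha hb
        subst ha hb
        intro h'
        exact hne (by rw [h', A.rev_rev, List.concat_eq_append])
    obtain ⟨z, h1, h2⟩ := joins_append hp
    have h3 : z = etgt e := by
      have := h2.revPath
      simp only [Graph.revPath, List.map_cons, List.map_nil, List.reverse_singleton,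
        A.rev_rev] at this
      exact this.end_unique (joins_edge e)
    subst h3
    rw [hp.tdist_eq rp, h1.tdist_eq rp.left, pathLength_append]
    simp [pathLength, elen, A.len_rev]

theorem edge_unique {e e' : A.TE} (h1 : esrc e = esrc e') (h2 : etgt e = etgt e') : e = e' := by
  have h3 := joins_edge e
  rw [h1, h2] at h3
  have := h3.unique (joins_edge e') (reduced_singleton _) (reduced_singleton _)
  have h4 : (esrc e).1 = (esrc e').1 := congrArg Prod.fst h1
  exact Prod.ext h4 (by simpa using this)

/-- An edge whose end points are separated by another edge coincides with it. -/
theorem edge_eq_of_separated {e e' : A.TE}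
    (h : tdist (esrc e) (esrc e') + elen e' + tdist (etgt e') (etgt e) ≤ elen e) : e = e' := by
  obtain ⟨p, rp, hp⟩ := exists_joins (esrc e) (esrc e')
  obtain ⟨q, rq, hq⟩ := exists_joins (etgt e') (etgt e)
  have hj := (hp.append (joins_edge e')).append hq
  rw [hp.tdist_eq rp, hq.tdist_eq rq, ← tdist_edge e] at h
  have hr := hj.reduced_of_le (by
    rw [pathLength_append, pathLength_append]
    simpa [pathLength, elen] using h)
  have hu := hj.unique (joins_edge e) hr (reduced_singleton _)
  have hl := congrArg List.length hu
  simp only [List.length_append, List.length_singleton] at hl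
  obtain rfl : p = [] := List.length_eq_zero_iff.1 (by omega)
  obtain rfl : q = [] := List.length_eq_zero_iff.1 (by omega)
  exact edge_unique (Joins.nil_iff.1 hp) (Joins.nil_iff.1 hq).symm

/-- Induction along the geodesics of the covering tree that start at `z`. -/
theorem tdist_induction (z : A.TV) {motive : A.TV → Prop} (h0 : motive z)
    (h1 : ∀ e : A.TE, tdist z (etgt e) = tdist z (esrc e) + elen e → motive (esrc e) →
      motive (etgt e)) (y : A.TV) : motive y := by
  obtain ⟨p, rp, hp⟩ := exists_joins z y
  induction p using List.reverseRecOn generalizing y with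
  | nil => exact Joins.nil_iff.1 hp ▸ h0
  | append_singleton p d ih =>
    obtain ⟨x, h2, h3⟩ := joins_append hp
    obtain ⟨h4, h5⟩ := h3.cons
    obtain rfl := Joins.nil_iff.1 h5
    refine h1 _ ?_ (h4.symm ▸ ih x rp.left h2)
    rw [h4, hp.tdist_eq rp, h2.tdist_eq rp.left, pathLength_append]
    simp [pathLength, elen]

theorem exists_last_edge {z y : A.TV} (h : z ≠ y) :
    ∃ e : A.TE, etgt e = y ∧ tdist z y = tdist z (esrc e) + elen e := by
  revert h
  refine tdist_induction z (motive := fun y => z ≠ y → ∃ e : A.TE, etgt e = y ∧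
    tdist z y = tdist z (esrc e) + elen e) (fun h => absurd rfl h) ?_ y
  exact fun e he _ _ => ⟨e, rfl, he⟩

theorem exists_first_edge {z y : A.TV} (h : z ≠ y) :
    ∃ e : A.TE, esrc e = z ∧ tdist z y = elen e + tdist (etgt e) y := by
  obtain ⟨e, h1, h2⟩ := exists_last_edge h.symm
  refine ⟨erev e, h1, ?_⟩
  rw [elen_erev, etgt_erev, treeMetric_tdist.symm z, h2, treeMetric_tdist.symm y, add_comm]

/-- Any three vertices of the covering tree have a median vertex. -/
theorem exists_median (x y z : A.TV) : ∃ m, tdist x y = tdist x m + tdist m y ∧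
    tdist x z = tdist x m + tdist m z ∧ tdist y z = tdist y m + tdist m z := by
  obtain ⟨p, rp, hp⟩ := exists_joins x y
  obtain ⟨q, rq, hq⟩ := exists_joins x z
  induction p generalizing q x with
  | nil =>
    obtain rfl := Joins.nil_iff.1 hp
    exact ⟨x, by simp [treeMetric_tdist.self]⟩
  | cons d p ih =>
    cases q with
    | nil =>
      obtain rfl := Joins.nil_iff.1 hq
      exact ⟨x, by simp [treeMetric_tdist.self]⟩
    | cons e q =>
      by_cases h : d = e
      · subst h
        obtain ⟨h1, h2⟩ := hp.cons
        obtain ⟨-, h3⟩ := hq.cons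
        obtain ⟨m, m1, m2, m3⟩ := ih _ rp.tail h2 q rq.tail h3
        refine ⟨m, ?_, ?_, m3⟩
        · have := treeMetric_tdist.triangle x (etgt (x.1, d)) m
          have e1 := hp.tdist_eq rp
          rw [pathLength_cons, ← h2.tdist_eq rp.tail] at e1
          have e2 := tdist_edge (x.1, d)
          rw [h1] at e2
          have := treeMetric_tdist.triangle x m y
          unfold elen at e2
          linarith
        · have := treeMetric_tdist.triangle x (etgt (x.1, d)) m
          have e1 := hq.tdist_eq rq
          rw [pathLength_cons, ← h3.tdist_eq rq.tail] at e1
          have e2 := tdist_edge (x.1, d)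
          rw [h1] at e2
          have := treeMetric_tdist.triangle x m z
          unfold elen at e2
          linarith
      -- The paths to `y` and `z` part at once, so `x` itself is the median.
      · refine ⟨x, by simp [treeMetric_tdist.self], by simp [treeMetric_tdist.self], ?_⟩
        rw [(hp.revPath.append hq).tdist_eq_red, A.pathLength_red_revPath_append rp rq,
          A.gromovProd_cons_ne h, treeMetric_tdist.symm y x, hp.tdist_eq rp, hq.tdist_eq rq]
        ring

/-- A loop in the class of `w` lifts to a path from some vertex `y` to `w y`, and conversely.
Together with `le_translationLength` this identifies the translation length with the infimum of the
vertex displacements. -/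
theorem translationLength_le (w : FreeGroup (Fin n)) (y : A.TV) :
    A.translationLength w ≤ tdist y (act w y) := by
  obtain ⟨p, -, hp⟩ := exists_joins ((1, A.base) : A.TV) y
  obtain ⟨c, rc, hc⟩ := exists_joins y (act w y)
  refine csInf_le ⟨0, ?_⟩ ⟨y.2, p, c, hp.1, hc.1, A.represents_iff.2 ?_, hc.tdist_eq rc⟩
  · rintro r ⟨_, _, c, _, _, _, rfl⟩
    exact A.pathLength_nonneg c
  · refine ⟨(hp.1.append hc.1).append hp.1.revPath, ?_⟩
    have h1 := hp.2
    have h2 := hc.2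
    simp only [one_mul, act] at h1 h2
    rw [holPath_append, holPath_append, A.holPath_revPath hp.1, h1, h2, mul_inv_cancel_right]

theorem le_translationLength (w : FreeGroup (Fin n)) {r : ℝ}
    (h : ∀ y : A.TV, r ≤ tdist y (act w y)) : r ≤ A.translationLength w := by
  refine le_csInf ?_ ?_
  · obtain ⟨c, hc⟩ := A.exists_represents w
    have h1 := (A.represents_iff.1 hc).1
    exact ⟨_, A.base, [], c, rfl, h1, by simpa [Graph.revPath] using hc, rfl⟩
  · rintro s ⟨u, p, c, hp, hc, hr, rfl⟩
    have h1 := (A.represents_iff.1 hr).2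
    rw [holPath_append, holPath_append, A.holPath_revPath hp] at h1
    refine (h (A.holPath p, u)).trans (Joins.tdist_le ⟨hc, ?_⟩)
    simp only [act]
    rw [← h1, inv_mul_cancel_right]

theorem translationLength_pos (A : MarkedMetricGraph n) {w : FreeGroup (Fin n)} (hw : w ≠ 1) :
    0 < A.translationLength w := by
  obtain ⟨m, hm, h⟩ := A.exists_le_len
  refine hm.trans_le (le_translationLength w fun y => le_tdist h fun h' => hw ?_)
  have := congrArg Prod.fst h'
  simpa [act] using this.symm

end MarkedMetricGraph

/-! ### Adding the points inside edges to a tree metric -/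

/-- A point on the segment between two points `x`, `y`, at distance `r` from `x`. -/
structure Seg {Y : Type*} (d : Y → Y → ℝ) where
  x : Y
  y : Y
  r : ℝ
  nonneg : 0 ≤ r
  le : r ≤ d x y

namespace Seg

variable {Y : Type*} {d : Y → Y → ℝ}

/-- The end points of the segment. -/
def pt (s : Seg d) (i : Bool) : Y := cond i s.x s.y

/-- The distances to the end points of the segment. -/
def off (s : Seg d) (i : Bool) : ℝ := cond i s.r (d s.x s.y - s.r)

theorem off_nonneg (s : Seg d) (i : Bool) : 0 ≤ s.off i := by
  cases i
  · exact sub_nonneg.2 s.le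
  · exact s.nonneg

/-- The distance between points on segments. -/
def sdist (s t : Seg d) : ℝ :=
  Finset.univ.sup' Finset.univ_nonempty
    fun i : Bool × Bool => d (s.pt i.1) (t.pt i.2) - s.off i.1 - t.off i.2

theorem le_sdist (s t : Seg d) (i j : Bool) :
    d (s.pt i) (t.pt j) - s.off i - t.off j ≤ sdist s t :=
  Finset.le_sup' (fun i : Bool × Bool => d (s.pt i.1) (t.pt i.2) - s.off i.1 - t.off i.2)
    (Finset.mem_univ (i, j))

theorem exists_sdist_eq (s t : Seg d) :
    ∃ i j, sdist s t = d (s.pt i) (t.pt j) - s.off i - t.off j := by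
  obtain ⟨i, -, hi⟩ := Finset.exists_mem_eq_sup' Finset.univ_nonempty
    fun i : Bool × Bool => d (s.pt i.1) (t.pt i.2) - s.off i.1 - t.off i.2
  exact ⟨i.1, i.2, hi⟩

/-- By `dist_between` at both points, the distance of two points of a tree must be the maximum that
defines `sdist`. Points are not identified, so different segments may give points at distance zero
and only a pseudometric results. The four point condition passes from the end points to the maximum.
-/
theorem treeMetric_sdist (h : TreeMetric d) : TreeMetric (sdist (d := d)) where
  self s := by
    apply le_antisymm
    · obtain ⟨i, j, e⟩ := exists_sdist_eq s s
      rw [e]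
      have h1 := s.nonneg
      have h2 := s.le
      have h3 := h.symm s.x s.y
      cases i <;> cases j <;> simp only [pt, off, cond_true, cond_false, h.self] <;> linarith
    · have := le_sdist s s true false
      simp only [pt, off, cond_true, cond_false] at this
      linarith
  symm s t := by
    have key : ∀ s t : Seg d, sdist s t ≤ sdist t s := fun s t => by
      obtain ⟨i, j, e⟩ := exists_sdist_eq s t
      have := le_sdist t s j i
      rw [h.symm] at this
      linarith
    exact le_antisymm (key s t) (key t s)
  four x y z w := by
    obtain ⟨i, j, e⟩ := exists_sdist_eq x y
    obtain ⟨k, l, e'⟩ := exists_sdist_eq z w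
    rcases le_max_iff.1 (h.four (x.pt i) (y.pt j) (z.pt k) (w.pt l)) with h1 | h1
    · exact le_max_of_le_left (by linarith [le_sdist x z i k, le_sdist y w j l])
    · exact le_max_of_le_right (by linarith [le_sdist x w i l, le_sdist y z j k])

/-- A point as a degenerate segment. -/
def emb (h : TreeMetric d) (y : Y) : Seg d := ⟨y, y, 0, le_rfl, (h.self y).ge⟩

theorem sdist_emb (h : TreeMetric d) (x y : Y) : sdist (emb h x) (emb h y) = d x y := by
  obtain ⟨i, j, e⟩ := exists_sdist_eq (emb h x) (emb h y)
  rw [e]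
  cases i <;> cases j <;> simp [pt, off, emb, h.self]

theorem sdist_pt (h : TreeMetric d) (s : Seg d) (i : Bool) :
    sdist s (emb h (s.pt i)) = s.off i := by
  apply le_antisymm
  · obtain ⟨k, j, e⟩ := exists_sdist_eq s (emb h (s.pt i))
    rw [e]
    have h1 := s.nonneg
    have h2 := s.le
    have h3 := h.symm s.x s.y
    cases i <;> cases j <;> cases k <;>
      simp only [pt, off, emb, cond_true, cond_false, h.self] <;> linarith
  · have h1 := le_sdist s (emb h (s.pt i)) (!i) true
    have h3 := h.symm s.x s.y
    cases i <;> simp [pt, off, emb, h.self] at h1 ⊢ <;> linarith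

theorem sdist_x (h : TreeMetric d) (s : Seg d) : sdist s (emb h s.x) = s.r :=
  sdist_pt h s true

theorem sdist_y (h : TreeMetric d) (s : Seg d) : sdist s (emb h s.y) = d s.x s.y - s.r :=
  sdist_pt h s false

/-- Any two points are joined by a segment. -/
theorem exists_between (h : TreeMetric d) (s t : Seg d) {a : ℝ} (ha : 0 ≤ a)
    (ha' : a ≤ sdist s t) : ∃ z, sdist z s = a ∧ sdist z t = sdist s t - a := by
  have H := treeMetric_sdist h
  obtain ⟨i, j, e⟩ := exists_sdist_eq s t
  have o1 := s.off_nonneg i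
  have o2 := t.off_nonneg j
  -- End points that realise the maximum are joined by a geodesic through `s` and `t`, so the
  -- required point lies on it at distance `a` beyond `s`.
  let z : Seg d := ⟨s.pt i, t.pt j, s.off i + a, by linarith, by linarith⟩
  have h1 : sdist z (emb h (s.pt i)) = s.off i + a := sdist_x h z
  have h2 : sdist z (emb h (t.pt j)) = sdist s t - a + t.off j := by
    rw [sdist_y h z]
    change d (s.pt i) (t.pt j) - (s.off i + a) = _
    linarith
  have h3 := H.dist_between h1 h2 (by rw [sdist_emb]; linarith)
  have h4 := H.triangle (emb h (t.pt j)) t s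
  have h5 := H.triangle (emb h (s.pt i)) s t
  have h6 := H.triangle (emb h (s.pt i)) s (emb h (t.pt j))
  have h7 := H.triangle (emb h (s.pt i)) t (emb h (t.pt j))
  have f1 := sdist_pt h s i
  have f2 := sdist_pt h t j
  have f3 := H.symm s (emb h (s.pt i))
  have f4 := H.symm t (emb h (t.pt j))
  have f5 := H.symm s (emb h (t.pt j))
  have f6 := H.symm s t
  rw [sdist_emb] at h6 h7
  refine ⟨z, ?_, ?_⟩
  · rw [h3]
    apply le_antisymm
    · exact max_le (by linarith) (by linarith)
    · exact le_max_of_le_right (by linarith)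
  · rw [h3]
    apply le_antisymm
    · exact max_le (by linarith) (by linarith)
    · exact le_max_of_le_left (by linarith)

end Seg

/-! ### The metric covering tree: projections to edges and compactness of balls -/

namespace MarkedMetricGraph

variable {n : ℕ} (A : MarkedMetricGraph n)

/-- The universal covering tree of a marked metric graph as a metric space. -/
abbrev TX : Type := Seg (tdist (A := A))

variable {A}

instance : PseudoMetricSpace A.TX where
  dist := Seg.sdist
  dist_self := (Seg.treeMetric_sdist treeMetric_tdist).self
  dist_comm := (Seg.treeMetric_sdist treeMetric_tdist).symm
  dist_triangle := (Seg.treeMetric_sdist treeMetric_tdist).triangle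

theorem treeMetric_dist : TreeMetric (dist : A.TX → A.TX → ℝ) :=
  Seg.treeMetric_sdist treeMetric_tdist

/-- A vertex as a point of the covering tree. -/
def vtx (y : A.TV) : A.TX := Seg.emb treeMetric_tdist y

theorem dist_vtx (x y : A.TV) : dist (vtx x) (vtx y) = tdist x y := Seg.sdist_emb _ x y

theorem exists_between (x y : A.TX) {a : ℝ} (ha : 0 ≤ a) (ha' : a ≤ dist x y) :
    ∃ z, dist z x = a ∧ dist z y = dist x y - a :=
  Seg.exists_between treeMetric_tdist x y ha ha'

/-- The action of the free group on the covering tree. -/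
def xact (g : FreeGroup (Fin n)) (s : A.TX) : A.TX :=
  ⟨act g s.x, act g s.y, s.r, s.nonneg, by rw [tdist_act]; exact s.le⟩

theorem dist_xact (g : FreeGroup (Fin n)) (s t : A.TX) :
    dist (xact g s) (xact g t) = dist s t := by
  have hp : ∀ (s : A.TX) i, (xact g s).pt i = act g (s.pt i) := fun s i => by cases i <;> rfl
  have ho : ∀ (s : A.TX) i, (xact g s).off i = s.off i := fun s i => by
    cases i
    · simp [Seg.off, xact, tdist_act]
    · rfl
  change Seg.sdist _ _ = Seg.sdist _ _
  simp only [Seg.sdist, hp, ho, tdist_act]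

theorem xact_vtx (g : FreeGroup (Fin n)) (y : A.TV) : xact g (vtx y) = vtx (act g y) := rfl

theorem xact_one (s : A.TX) : xact 1 s = s := by
  simp [xact, act_one]

theorem xact_mul (g h : FreeGroup (Fin n)) (s : A.TX) : xact (g * h) s = xact g (xact h s) := by
  simp [xact, act_mul]

theorem dist_xact_left (g : FreeGroup (Fin n)) (s t : A.TX) :
    dist (xact g s) t = dist s (xact g⁻¹ t) := by
  rw [← dist_xact g⁻¹ (xact g s), ← xact_mul, inv_mul_cancel, xact_one]

/-- The position of the projection of a point to an edge. -/
def tpos (e : A.TE) (x : A.TX) : ℝ := (dist x (vtx (esrc e)) + elen e - dist x (vtx (etgt e))) / 2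

theorem dist_edge (e : A.TE) : dist (vtx (esrc e)) (vtx (etgt e)) = elen e := by
  rw [dist_vtx, tdist_edge]

theorem tpos_nonneg (e : A.TE) (x : A.TX) : 0 ≤ tpos e x := by
  have := dist_triangle x (vtx (esrc e)) (vtx (etgt e))
  rw [dist_edge] at this
  unfold tpos
  linarith

theorem tpos_le (e : A.TE) (x : A.TX) : tpos e x ≤ elen e := by
  have := dist_triangle x (vtx (etgt e)) (vtx (esrc e))
  rw [dist_comm (vtx (etgt e)), dist_edge] at this
  unfold tpos
  linarith

theorem tpos_erev (e : A.TE) (x : A.TX) : tpos (erev e) x = elen e - tpos e x := by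
  unfold tpos
  rw [esrc_erev, etgt_erev, elen_erev]
  ring

theorem tpos_xact (g : FreeGroup (Fin n)) (e : A.TE) (x : A.TX) :
    tpos (eact g e) (xact g x) = tpos e x := by
  unfold tpos
  rw [esrc_eact, etgt_eact, ← xact_vtx, ← xact_vtx, dist_xact, dist_xact, elen_eact]

/-- Points with different projections to an edge are separated by the segment between the
projections. -/
theorem le_dist_of_tpos_lt {e : A.TE} {x y : A.TX} (h : tpos e x < tpos e y) :
    (dist x (vtx (esrc e)) - tpos e x) + (tpos e y - tpos e x) +
      (dist y (vtx (esrc e)) - tpos e y) ≤ dist x y := by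
  have h4 := treeMetric_dist.four y (vtx (esrc e)) x (vtx (etgt e))
  rw [dist_comm y x, dist_edge] at h4
  rcases le_max_iff.1 h4 with h1 | h1 <;> unfold tpos at * <;>
    linarith [dist_comm (vtx (esrc e)) x, dist_comm (vtx (etgt e)) x]

theorem tpos_vtx (e : A.TE) (y : A.TV) : tpos e (vtx y) = 0 ∨ tpos e (vtx y) = elen e := by
  unfold tpos
  rw [dist_vtx, dist_vtx]
  rcases tdist_edge_cases y e with h | h
  · left
    linarith
  · right
    linarith

/-- If `e'` separated the ends of `e`, the geodesic between these ends, which is the single edge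
`e`, would run through `e'`. -/
theorem tpos_esrc_eq_etgt_aux {e e' : A.TE} (h : e ≠ e') (h0 : tpos e' (vtx (esrc e)) = 0)
    (h1 : tpos e' (vtx (etgt e)) = elen e') : False := by
  have := le_dist_of_tpos_lt (e := e') (x := vtx (esrc e)) (y := vtx (etgt e))
    (by rw [h0, h1]; exact elen_pos _)
  refine h (edge_eq_of_separated ?_)
  rw [dist_edge, h0, h1, dist_vtx, dist_vtx] at this
  unfold tpos at h1
  rw [dist_vtx, dist_vtx] at h1
  rw [treeMetric_tdist.symm (etgt e')]
  linarith

theorem tpos_esrc_eq_etgt {e e' : A.TE} (h : e ≠ e') (h' : e ≠ erev e') :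
    tpos e' (vtx (esrc e)) = tpos e' (vtx (etgt e)) := by
  rcases tpos_vtx e' (esrc e) with h0 | h0 <;> rcases tpos_vtx e' (etgt e) with h1 | h1
  · rw [h0, h1]
  · exact (tpos_esrc_eq_etgt_aux h h0 h1).elim
  · exact (tpos_esrc_eq_etgt_aux h' (by rw [tpos_erev, h0, sub_self])
      (by rw [tpos_erev, h1, sub_zero, elen_erev])).elim
  · rw [h0, h1]

/-- The point `x` lies on the edge `e`. -/
def OnEdge (e : A.TE) (x : A.TX) : Prop :=
  dist x (vtx (esrc e)) + dist x (vtx (etgt e)) = elen e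

theorem OnEdge.tpos_eq {e e' : A.TE} {x : A.TX} (hx : OnEdge e x) (h : e ≠ e')
    (h' : e ≠ erev e') : tpos e' x = tpos e' (vtx (esrc e)) := by
  have h1 := tpos_esrc_eq_etgt h h'
  have key := treeMetric_dist.dist_between rfl rfl ((dist_edge e).trans hx.symm)
  rcases tpos_vtx e' (esrc e) with h0 | h0
  · rw [h0]
    rw [h0] at h1
    unfold tpos at h0 h1 ⊢
    have e1 : dist (vtx (esrc e)) (vtx (etgt e')) = dist (vtx (esrc e)) (vtx (esrc e')) + elen e' :=
      by linarith
    have e2 : dist (vtx (etgt e)) (vtx (etgt e')) = dist (vtx (etgt e)) (vtx (esrc e')) + elen e' :=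
      by linarith
    have k1 := key (vtx (esrc e'))
    have k2 := key (vtx (etgt e'))
    rw [e1, e2, add_sub_right_comm, add_sub_right_comm, max_add_add_right] at k2
    linarith
  · rw [h0]
    rw [h0] at h1
    unfold tpos at h0 h1 ⊢
    have e1 : dist (vtx (esrc e)) (vtx (esrc e')) = dist (vtx (esrc e)) (vtx (etgt e')) + elen e' :=
      by linarith
    have e2 : dist (vtx (etgt e)) (vtx (esrc e')) = dist (vtx (etgt e)) (vtx (etgt e')) + elen e' :=
      by linarith
    have k1 := key (vtx (esrc e'))
    have k2 := key (vtx (etgt e'))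
    rw [e1, e2, add_sub_right_comm, add_sub_right_comm, max_add_add_right] at k1
    linarith

/-- The point on an edge at a given position. -/
def edgePt (e : A.TE) (r : ℝ) (h0 : 0 ≤ r) (h1 : r ≤ elen e) : A.TX :=
  ⟨esrc e, etgt e, r, h0, by rwa [tdist_edge]⟩

theorem dist_edgePt_esrc (e : A.TE) {r : ℝ} (h0 : 0 ≤ r) (h1 : r ≤ elen e) :
    dist (edgePt e r h0 h1) (vtx (esrc e)) = r := Seg.sdist_x treeMetric_tdist (edgePt e r h0 h1)

theorem dist_edgePt_etgt (e : A.TE) {r : ℝ} (h0 : 0 ≤ r) (h1 : r ≤ elen e) :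
    dist (edgePt e r h0 h1) (vtx (etgt e)) = elen e - r :=
  (Seg.sdist_y treeMetric_tdist (edgePt e r h0 h1)).trans
    (congrArg (fun t => t - r) (tdist_edge e))

theorem dist_edgePt (e : A.TE) {r : ℝ} (h0 : 0 ≤ r) (h1 : r ≤ elen e) (x : A.TX) :
    dist (edgePt e r h0 h1) x =
      max (dist (vtx (esrc e)) x - r) (dist (vtx (etgt e)) x - (elen e - r)) :=
  treeMetric_dist.dist_between (dist_edgePt_esrc e h0 h1) (dist_edgePt_etgt e h0 h1)
    (by rw [dist_edge]; ring) x

theorem onEdge_edgePt (e : A.TE) {r : ℝ} (h0 : 0 ≤ r) (h1 : r ≤ elen e) :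
    OnEdge e (edgePt e r h0 h1) := by
  unfold OnEdge
  rw [dist_edgePt_esrc, dist_edgePt_etgt]
  ring

theorem dist_proj (e : A.TE) (x : A.TX) :
    dist (edgePt e (tpos e x) (tpos_nonneg e x) (tpos_le e x)) x =
      dist x (vtx (esrc e)) - tpos e x := by
  rw [dist_edgePt, dist_comm (vtx (esrc e)), dist_comm (vtx (etgt e))]
  have : dist x (vtx (etgt e)) - (elen e - tpos e x) = dist x (vtx (esrc e)) - tpos e x := by
    unfold tpos
    ring
  rw [this, max_self]

/-- Induction on the number of edges. If `e` separates `x` from `y`, the geodesic is cut at the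
projections `z` and `z'` to `e`. Edges other than `e` and its reverse do not distinguish `z` from
`z'`, so their variation lives on the two outer pieces; `e` and its reverse each contribute the
middle piece, whence the factor two. -/
theorem sum_tpos_le_aux (k : ℕ) : ∀ (S : Finset A.TE), S.card ≤ k → ∀ x y : A.TX,
    ∑ e ∈ S, |tpos e x - tpos e y| ≤ 2 * dist x y := by
  classical
  induction k with
  | zero =>
    intro S hS x y
    rw [Finset.card_eq_zero.1 (Nat.le_zero.1 hS), Finset.sum_empty]
    positivity
  | succ k ih =>
    have key : ∀ (S : Finset A.TE), S.card ≤ k + 1 → ∀ x y : A.TX, ∀ e ∈ S,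
        tpos e x < tpos e y → ∑ e ∈ S, |tpos e x - tpos e y| ≤ 2 * dist x y := by
      intro S hS x y e he hlt
      have hc : ((S.erase e).erase (erev e)).card ≤ k := by
        have h1 := Finset.card_erase_le (s := S.erase e) (a := erev e)
        have h2 := Finset.card_erase_of_mem he
        omega
      have hsep := le_dist_of_tpos_lt hlt
      set z := edgePt e (tpos e x) (tpos_nonneg e x) (tpos_le e x) with hz
      set z' := edgePt e (tpos e y) (tpos_nonneg e y) (tpos_le e y) with hz'
      have d1 : dist z x = _ := dist_proj e x
      have d2 : dist z' y = _ := dist_proj e y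
      have i1 := ih _ hc x z
      have i2 := ih _ hc z' y
      have hle : ∑ e' ∈ (S.erase e).erase (erev e), |tpos e' x - tpos e' y| ≤
          ∑ e' ∈ (S.erase e).erase (erev e), |tpos e' x - tpos e' z| +
          ∑ e' ∈ (S.erase e).erase (erev e), |tpos e' z' - tpos e' y| := by
        rw [← Finset.sum_add_distrib]
        refine Finset.sum_le_sum fun e' he' => ?_
        have m1 := (Finset.mem_erase.1 he').1
        have m2 := (Finset.mem_erase.1 (Finset.mem_erase.1 he').2).1
        have m3 : e ≠ erev e' := fun h => m1 (by rw [h, erev_erev])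
        have t1 : tpos e' z = tpos e' (vtx (esrc e)) :=
          (onEdge_edgePt e _ _).tpos_eq (Ne.symm m2) m3
        have t2 : tpos e' z' = tpos e' (vtx (esrc e)) :=
          (onEdge_edgePt e _ _).tpos_eq (Ne.symm m2) m3
        rw [t1, t2]
        exact abs_sub_le _ _ _
      have hrev : ∑ e' ∈ S.erase e, |tpos e' x - tpos e' y| ≤
          ∑ e' ∈ (S.erase e).erase (erev e), |tpos e' x - tpos e' y| + (tpos e y - tpos e x) := by
        by_cases hm : erev e ∈ S.erase e
        · rw [← Finset.sum_erase_add _ _ hm, tpos_erev, tpos_erev]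
          gcongr
          rw [abs_of_pos (by linarith)]
          linarith
        · rw [Finset.erase_eq_of_notMem hm]
          linarith
      rw [← Finset.sum_erase_add _ _ he, abs_of_neg (by linarith)]
      rw [dist_comm x z] at i1
      linarith
    intro S hS x y
    by_cases h : ∃ e ∈ S, tpos e x ≠ tpos e y
    · obtain ⟨e, he, hne⟩ := h
      rcases lt_or_gt_of_ne hne with h1 | h1
      · exact key S hS x y e he h1
      · have := key S hS y x e he h1
        rw [dist_comm]
        simpa only [abs_sub_comm] using this
    · push Not at h
      rw [Finset.sum_eq_zero fun e he => by rw [h e he, sub_self, abs_zero]]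
      positivity

/-- The total variation of the projections to the edges is bounded by the distance. -/
theorem sum_tpos_le (S : Finset A.TE) (x y : A.TX) :
    ∑ e ∈ S, |tpos e x - tpos e y| ≤ 2 * dist x y := sum_tpos_le_aux _ S le_rfl x y

theorem exists_esrc_eq (y : A.TV) : ∃ e : A.TE, esrc e = y := by
  have h := A.three_le_valence y.2
  have : Nonempty {d : A.D // A.src d = y.2} := by
    by_contra h'
    rw [not_nonempty_iff] at h'
    simp at h
  obtain ⟨d, hd⟩ := this
  exact ⟨(y.1, d), Prod.ext rfl hd⟩

/-- A point is given on a segment between two arbitrary vertices; following the geodesic edge by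
edge from one of them reaches an edge that contains it. -/
theorem exists_onEdge (x : A.TX) : ∃ e, OnEdge e x := by
  have key : ∀ (y : A.TV) (x' : A.TX),
      dist x' (vtx x.x) + dist x' (vtx y) = tdist x.x y → ∃ e, OnEdge e x' := by
    refine fun y => tdist_induction x.x (motive := fun y => ∀ x' : A.TX,
      dist x' (vtx x.x) + dist x' (vtx y) = tdist x.x y → ∃ e, OnEdge e x') ?_ ?_ y
    · intro x' h
      rw [treeMetric_tdist.self] at h
      obtain ⟨e, he⟩ := exists_esrc_eq x.x
      refine ⟨e, ?_⟩
      have h1 : dist x' (vtx (esrc e)) = 0 := by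
        rw [he]
        linarith
      have h2 := dist_triangle x' (vtx (esrc e)) (vtx (etgt e))
      have h3 := dist_triangle_left (vtx (esrc e)) (vtx (etgt e)) x'
      rw [dist_edge] at h2 h3
      unfold OnEdge
      linarith
    · intro e he ih x' h
      have key := treeMetric_dist.dist_between rfl rfl
        ((dist_vtx _ _).trans h.symm) (vtx (esrc e))
      rw [dist_vtx, dist_vtx, treeMetric_tdist.symm (etgt e), tdist_edge] at key
      have e1 : elen e - dist x' (vtx (etgt e)) =
          dist x' (vtx x.x) - tdist x.x (esrc e) := by linarith
      rw [e1] at key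
      rcases le_total (dist x' (vtx x.x)) (tdist x.x (esrc e)) with hc | hc
      · rw [max_eq_left (by linarith)] at key
        exact ih x' (by linarith)
      · rw [max_eq_right (by linarith)] at key
        exact ⟨e, by unfold OnEdge; linarith⟩
  refine key x.y x ?_
  have h1 : dist x (vtx x.x) = x.r := Seg.sdist_x treeMetric_tdist x
  have h2 : dist x (vtx x.y) = tdist x.x x.y - x.r := Seg.sdist_y treeMetric_tdist x
  linarith

theorem finite_edges (o : A.TV) (R : ℝ) : {e : A.TE | tdist o (esrc e) ≤ R}.Finite := by
  obtain ⟨m, hm, hlen⟩ := A.exists_le_len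
  have hf := (List.finite_length_le A.D ⌊R / m⌋₊).prod (Set.finite_univ (α := A.D))
  refine (hf.image fun q : List A.D × A.D => ((o.1 * A.holPath q.1, q.2) : A.TE)).subset ?_
  intro e he
  obtain ⟨p, rp, hp⟩ := exists_joins o (esrc e)
  rw [Set.mem_ofPred_eq, hp.tdist_eq rp] at he
  refine ⟨(p, e.2), ⟨?_, trivial⟩, Prod.ext hp.2 rfl⟩
  refine Nat.le_floor ?_
  rw [le_div_iff₀ hm]
  exact (mul_length_le hlen p).trans he

/-- The closure is needed because a point at distance zero from a point of the edge need not be of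
the form `edgePt`. -/
theorem isCompact_closure_edge (e : A.TE) : IsCompact (closure (Set.range
    fun r : Set.Icc 0 (elen e) => edgePt e r.1 r.2.1 r.2.2)) := by
  refine (isCompact_range ?_).closure
  refine Isometry.continuous (Isometry.of_dist_eq fun r s => ?_)
  rw [dist_edgePt, dist_comm, dist_edgePt_esrc, dist_comm, dist_edgePt_etgt, Subtype.dist_eq,
    Real.dist_eq, abs_sub_comm, abs_eq_max_neg]
  congr 1
  ring

theorem isCompact_closedBall (o : A.TV) (M : ℝ) : IsCompact (Metric.closedBall (vtx o) M) := by
  obtain ⟨m, hm, hlen⟩ := A.exists_len_le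
  refine ((finite_edges o (M + m)).isCompact_biUnion fun e _ =>
    isCompact_closure_edge e).of_isClosed_subset Metric.isClosed_closedBall ?_
  intro x hx
  rw [Metric.mem_closedBall] at hx
  obtain ⟨e, he⟩ := exists_onEdge x
  have he' : dist x (vtx (esrc e)) + dist x (vtx (etgt e)) = elen e := he
  have hl : elen e ≤ m := hlen e.2
  refine Set.mem_biUnion (x := e) ?_ ?_
  · have := dist_triangle_left (vtx o) (vtx (esrc e)) x
    rw [dist_vtx] at this
    have h0 : 0 ≤ dist x (vtx (etgt e)) := dist_nonneg
    change tdist o (esrc e) ≤ M + m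
    linarith
  · refine Metric.mem_closure_iff.2 fun ε hε =>
      ⟨_, ⟨⟨tpos e x, tpos_nonneg e x, tpos_le e x⟩, rfl⟩, ?_⟩
    rw [dist_comm, dist_proj]
    unfold tpos
    linarith

/-- Conditions that can be satisfied approximately in a bounded set can be satisfied. -/
theorem exists_of_approx {ι : Type*} (C : ι → A.TX → ℝ) (hC : ∀ i, Continuous (C i)) (o : A.TV)
    (M : ℝ) (h : ∀ ε > 0, ∃ x, dist x (vtx o) ≤ M ∧ ∀ i, C i x ≤ ε) : ∃ x, ∀ i, C i x ≤ 0 := by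
  choose x hx hc using fun k : ℕ => h (1 / ((k : ℝ) + 1)) (by positivity)
  obtain ⟨a, -, φ, hφ, ha⟩ := (isCompact_closedBall o M).tendsto_subseq
    fun k => Metric.mem_closedBall.2 (hx k)
  refine ⟨a, fun i => ?_⟩
  exact le_of_tendsto_of_tendsto' (((hC i).tendsto a).comp ha)
    (tendsto_one_div_add_atTop_nhds_zero_nat.comp hφ.tendsto_atTop) fun k => hc _ i

end MarkedMetricGraph

/-! ### Long reduced paths and cyclically reduced loops -/

namespace MarkedMetricGraph

open OuterSpace.Graph

variable {n : ℕ} {A : MarkedMetricGraph n}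

theorem exists_three_edges (v : A.V) : ∃ a b c : A.D, A.src a = v ∧ A.src b = v ∧ A.src c = v ∧
    a ≠ b ∧ a ≠ c ∧ b ≠ c := by
  classical
  have h := A.three_le_valence v
  rw [Nat.card_eq_fintype_card] at h
  obtain ⟨a, b, c, h1, h2, h3⟩ := Fintype.two_lt_card_iff.1 h
  exact ⟨a.1, b.1, c.1, a.2, b.2, c.2, fun h => h1 (Subtype.ext h), fun h => h2 (Subtype.ext h),
    fun h => h3 (Subtype.ext h)⟩

theorem exists_two_edges (v : A.V) (x : A.D) : ∃ a b : A.D, A.src a = v ∧ A.src b = v ∧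
    a ≠ b ∧ a ≠ x ∧ b ≠ x := by
  obtain ⟨a, b, c, ha, hb, hc, h1, h2, h3⟩ := exists_three_edges v
  by_cases ha' : a = x
  · subst ha'
    exact ⟨b, c, hb, hc, h3, h1.symm, h2.symm⟩
  by_cases hb' : b = x
  · subst hb'
    exact ⟨a, c, ha, hc, h2, ha', h3.symm⟩
  exact ⟨a, b, ha, hb, h1, ha', hb'⟩

/-- The edge `e` can follow the edge `d` in a reduced path. -/
def Follows (d e : A.D) : Prop := A.src e = A.tgt d ∧ e ≠ A.rev d

theorem Follows.rev {d e : A.D} (h : Follows d e) : Follows (A.rev e) (A.rev d) := by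
  refine ⟨?_, ?_⟩
  · rw [Graph.tgt_rev]
    exact h.1.symm
  · rw [A.rev_rev]
    exact fun h' => h.2 h'.symm

theorem transGen_follows_rev {d e : A.D} (h : Relation.TransGen Follows d e) :
    Relation.TransGen Follows (A.rev e) (A.rev d) := by
  induction h with
  | single h => exact .single h.rev
  | tail _ h ih => exact Relation.TransGen.head h.rev ih

/-- A reduced path can turn around. -/
theorem transGen_follows_self_rev (d : A.D) : Relation.TransGen Follows d (A.rev d) := by
  classical
  by_contra hd
  -- From `rev f` the reverse of a path from `d` to `f` leads on to `rev d`.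
  have h1 : ∀ f, Relation.TransGen Follows d f → ¬ Relation.TransGen Follows d (A.rev f) :=
    fun f hf hf' => hd (hf'.trans (transGen_follows_rev hf))
  let R := {f : A.D // Relation.TransGen Follows d f}
  -- Otherwise `f'` could be followed by `rev f`, which `h1` forbids.
  have h2 : ∀ f f' : R, A.tgt f.1 = A.tgt f'.1 → f = f' := fun f f' h => by
    by_contra hne
    refine h1 f.1 f.2 (f'.2.tail ⟨h, fun h' => hne (Subtype.ext (Graph.rev_inj.1 h'))⟩)
  choose a b ha hb hab ha' hb' using fun f : R => exists_two_edges (A.tgt f.1) (A.rev f.1)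
  -- Valence three gives every reachable edge two reachable successors. By `h2` a successor
  -- determines its predecessor through its source, so the finite nonempty set `R` would have at
  -- least twice its own cardinality.
  let φ : R × Bool → R := fun x => cond x.2 ⟨a x.1, x.1.2.tail ⟨ha x.1, ha' x.1⟩⟩
    ⟨b x.1, x.1.2.tail ⟨hb x.1, hb' x.1⟩⟩
  have hsrc : ∀ x, A.src (φ x).1 = A.tgt x.1.1 := by
    rintro ⟨f, i⟩
    cases i
    · exact hb f
    · exact ha f
  have hφ : Function.Injective φ := by
    rintro ⟨f, i⟩ ⟨f', j⟩ h
    obtain rfl : f = f' := h2 _ _ (by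
      have e1 := hsrc (f, i)
      rw [h, hsrc (f', j)] at e1
      exact e1.symm)
    have h' := congrArg Subtype.val h
    cases i <;> cases j
    · rfl
    · exact absurd h'.symm (hab f)
    · exact absurd h' (hab f)
    · rfl
  have hc := Fintype.card_le_of_injective φ hφ
  rw [Fintype.card_prod, Fintype.card_bool] at hc
  obtain ⟨x, _, hx, _, _, hx', _⟩ := exists_two_edges (A.tgt d) (A.rev d)
  have : 0 < Fintype.card R := Fintype.card_pos_iff.2 ⟨⟨x, .single ⟨hx, hx'⟩⟩⟩
  omega

/-- Any two edges are joined by a reduced path. -/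
theorem transGen_follows (d e : A.D) : Relation.TransGen Follows d e := by
  have h1 : ∀ f, (f = d ∨ Relation.TransGen Follows d f) → ∀ x, A.src x = A.tgt f →
      Relation.TransGen Follows d x := fun f hf x hx => by
    have hfx : Relation.TransGen Follows f x := by
      by_cases h : x = A.rev f
      · exact h ▸ transGen_follows_self_rev f
      · exact .single ⟨hx, h⟩
    rcases hf with rfl | hf
    · exact hfx
    · exact hf.trans hfx
  have h2 : ∀ (p : List A.D) (u v : A.V), A.IsPath u p v →
      (∀ x, A.src x = u → Relation.TransGen Follows d x) →
      ∀ x, A.src x = v → Relation.TransGen Follows d x := by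
    intro p
    induction p with
    | nil =>
      intro u v h hu
      obtain rfl : u = v := h
      exact hu
    | cons f p ih =>
      intro u v h hu
      exact ih _ _ h.2 (h1 f (.inr (hu f h.1)))
  obtain ⟨p, hp⟩ := A.connected (A.tgt d) (A.src e)
  exact h2 p _ _ hp (h1 d (.inl rfl)) e rfl

theorem exists_path_of_transGen {d e : A.D} (h : Relation.TransGen Follows d e) :
    ∃ q, A.IsPath (A.tgt d) q (A.src e) ∧ Reduced (d :: (q ++ [e])) := by
  induction h with
  | single h => exact ⟨[], h.1.symm, reduced_cons_cons.2 ⟨h.2, reduced_singleton _⟩⟩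
  | tail _ h ih =>
    rename_i b c _
    obtain ⟨q, hq, hr⟩ := ih
    refine ⟨q ++ [b], hq.append ⟨rfl, h.1.symm⟩, ?_⟩
    rw [← List.cons_append]
    refine List.isChain_append.2 ⟨hr, reduced_singleton _, ?_⟩
    rw [← List.cons_append]
    intro x hx y hy
    simp only [List.getLast?_append, List.getLast?_singleton, Option.some_or,
      Option.mem_def, Option.some.injEq, List.head?_cons] at hx hy
    subst hx hy
    exact h.2

/-- Every edge is the beginning of arbitrarily long reduced paths to the base vertex. -/
theorem exists_long_path (d : A.D) (M : ℝ) :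
    ∃ q, A.IsPath (A.tgt d) q A.base ∧ Reduced (d :: q) ∧ M ≤ A.pathLength q := by
  obtain ⟨m, hm, hlen⟩ := A.exists_le_len
  have key : ∀ k : ℕ, ∀ d : A.D, ∃ q, A.IsPath (A.tgt d) q A.base ∧ Reduced (d :: q) ∧
      k ≤ q.length := by
    intro k
    induction k with
    | zero =>
      intro d
      obtain ⟨e, _, _, he, _⟩ := exists_three_edges A.base
      obtain ⟨q, hq, hr⟩ := exists_path_of_transGen (transGen_follows d e)
      rw [← List.cons_append] at hr
      exact ⟨q, he ▸ hq, hr.left, Nat.zero_le _⟩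
    | succ k ih =>
      intro d
      obtain ⟨x, _, hx, _, _, hx', _⟩ := exists_two_edges (A.tgt d) (A.rev d)
      obtain ⟨q, hq, hr, hk⟩ := ih x
      exact ⟨x :: q, ⟨hx, hq⟩, reduced_cons_cons.2 ⟨hx', hr⟩, by simpa using hk⟩
  obtain ⟨k, hk⟩ := exists_nat_ge (M / m)
  obtain ⟨q, hq, hr, hl⟩ := key k d
  refine ⟨q, hq, hr, ?_⟩
  rw [div_le_iff₀ hm] at hk
  have h1 : (k : ℝ) * m ≤ q.length * m := by gcongr
  exact hk.trans (h1.trans (mul_length_le hlen q))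

/-- Every orbit has points on the far side of every edge. -/
theorem exists_tpos_eq (e : A.TE) (x : A.TX) : ∃ g, tpos e (xact g x) = elen e := by
  let o : A.TV := (1, A.base)
  -- The path beyond `e` is longer than the distance from `o` to `x`, so `g x`, which is that close
  -- to `g o`, cannot be back across `e`.
  obtain ⟨q, hq, hr, hl⟩ := exists_long_path e.2 (dist (vtx o) x + 1)
  let g := e.1 * A.hol e.2 * A.holPath q
  refine ⟨g, le_antisymm (tpos_le _ _) ?_⟩
  have hj : A.Joins (etgt e) q (act g o) := ⟨hq, by simp [act, o, g, etgt]⟩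
  have h1 := hj.tdist_eq hr.tail
  have h2 := ((joins_edge e).append hj).tdist_eq hr
  have h4 := treeMetric_dist.four (vtx (act g o)) (vtx (esrc e)) (xact g x) (vtx (etgt e))
  have h5 : dist (vtx (act g o)) (xact g x) = dist (vtx o) x := by rw [← xact_vtx, dist_xact]
  rw [h5, dist_edge, dist_vtx, dist_vtx, treeMetric_tdist.symm, h2, treeMetric_tdist.symm, h1,
    dist_comm (vtx (esrc e))] at h4
  have h6 : A.pathLength ([e.2] ++ q) = elen e + A.pathLength q := rfl
  rw [h6] at h4
  have h7 : 0 ≤ dist (xact g x) (vtx (etgt e)) := dist_nonneg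
  unfold tpos
  rcases le_max_iff.1 h4 with h | h <;> linarith

/-- Up to a bounded correction, the displacement of a point is a translation length. -/
theorem exists_finite_correction (A : MarkedMetricGraph n) : ∃ S : Set (FreeGroup (Fin n)),
    S.Finite ∧ ∀ g, ∃ a ∈ S, tdist ((1, A.base) : A.TV) (act g (1, A.base)) ≤
      tdist ((1, A.base) : A.TV) (act (g * a) (act (g * a) (1, A.base))) -
      tdist ((1, A.base) : A.TV) (act (g * a) (1, A.base)) := by
  -- `q (e, d)` closes a reduced loop with first edge `d` and last edge `e` to a cyclically reduced
  -- one; the correcting factors are the holonomies of these finitely many paths.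
  choose q hq hr using fun x : A.D × A.D => exists_path_of_transGen (transGen_follows x.1 x.2)
  refine ⟨insert 1 (Set.range fun x => A.holPath (q x)), (Set.finite_range _).insert _, ?_⟩
  intro g
  obtain ⟨p, rp, hp⟩ := exists_joins ((1, A.base) : A.TV) (act g (1, A.base))
  rcases List.eq_nil_or_concat p with rfl | ⟨p', e, rfl⟩
  · refine ⟨1, Set.mem_insert _ _, ?_⟩
    rw [mul_one, ← Joins.nil_iff.1 hp, ← Joins.nil_iff.1 hp, sub_self, treeMetric_tdist.self]
  · rw [List.concat_eq_append] at rp hp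
    obtain ⟨d, p'', hd⟩ : ∃ d p'', p' ++ [e] = d :: p'' := by
      cases p' with
      | nil => exact ⟨_, _, rfl⟩
      | cons d p' => exact ⟨d, p' ++ [e], rfl⟩
    refine ⟨A.holPath (q (e, d)), Set.mem_insert_of_mem _ ⟨_, rfl⟩, ?_⟩
    set a := A.holPath (q (e, d)) with ha
    have hsd : A.src d = A.base := by
      have := hp.1
      rw [hd] at this
      exact this.1
    have hte : A.tgt e = A.base := by
      obtain ⟨v, -, -, h⟩ := isPath_append.1 hp.1
      exact h
    have hj : ∀ x : FreeGroup (Fin n), A.Joins (act x (1, A.base)) (p' ++ [e] ++ q (e, d))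
        (act (x * (g * a)) (1, A.base)) := fun x => by
      refine ⟨hp.1.append ?_, ?_⟩
      · have := hq (e, d)
        simp only [hte, hsd] at this
        exact this
      · have := hp.2
        simp only [act, mul_one, one_mul] at this ⊢
        rw [holPath_append, this]
    -- The closed-up loop stays reduced when run twice. Hence the difference of the displacements of
    -- `(g * a)²` and `g * a` is the length of the loop, at least that of the path for `g`.
    have r1 : Reduced (p' ++ [e] ++ q (e, d) ++ (p' ++ [e] ++ q (e, d))) := by
      have h := hr (e, d)
      have r0 : Reduced (p' ++ [e] ++ (q (e, d) ++ [d])) := by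
        refine List.isChain_append.2 ⟨rp, List.IsChain.tail h, ?_⟩
        intro x hx y hy
        simp only [List.getLast?_append, List.getLast?_singleton, Option.some_or,
          Option.mem_def, Option.some.injEq] at hx
        subst hx
        have h' : Reduced ([e] ++ (q (e, d) ++ [d])) := h
        exact (List.isChain_append.1 h').2.2 _ (by simp) _ hy
      have r2 : Reduced (p' ++ [e] ++ q (e, d)) := by
        rw [← List.append_assoc] at r0
        exact r0.left
      refine List.isChain_append.2 ⟨r2, r2, ?_⟩
      rw [← List.append_assoc] at r0
      intro x hx y hy
      refine (List.isChain_append.1 r0).2.2 x hx y ?_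
      rw [hd] at hy
      exact hy
    have j1 := hj 1
    rw [act_one, one_mul] at j1
    have j2 := j1.append (hj (g * a))
    rw [act_mul] at j2
    rw [j2.tdist_eq r1, j1.tdist_eq r1.left, hp.tdist_eq rp]
    simp only [pathLength_append]
    linarith [A.pathLength_nonneg (q (e, d))]

end MarkedMetricGraph

/-! ### Equivariant maps that do not increase distances -/

namespace MarkedMetricGraph

variable {n : ℕ} {A B : MarkedMetricGraph n}

theorem isometry_xact (g : FreeGroup (Fin n)) : Isometry (xact (A := A) g) :=
  Isometry.of_dist_eq (dist_xact g)

/-- A point on the segment from `o` to `p` that is moved little by the group and is close to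
prescribed centres. -/
theorem exists_displaced_le {ι : Type*} {N : FreeGroup (Fin n) → ℝ} {c : ι → A.TX} {R : ι → ℝ}
    {o p : A.TX} {s t ε : ℝ} (ht : 0 ≤ t) (hs : 0 ≤ s) (hop : dist o p = t + s)
    (hN : ∀ g, N g⁻¹ = N g)
    (h1 : ∀ g, dist o (xact g o) ≤ N g + 2 * t + ε)
    (h2 : ∀ g, dist o (xact g p) ≤ N g + t + s + ε)
    (h3 : ∀ g, dist p (xact g p) ≤ N g + 2 * s + ε)
    (h4 : ∀ i, dist o (c i) ≤ R i + t + ε) (h5 : ∀ i, dist p (c i) ≤ R i + s + ε) :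
    ∃ x, dist x o = t ∧ (∀ g, dist x (xact g x) ≤ N g + ε) ∧ ∀ i, dist x (c i) ≤ R i + ε := by
  obtain ⟨x, hx, hx'⟩ := exists_between o p ht (by linarith)
  have hx'' : dist x p = s := by linarith
  have key := treeMetric_dist.dist_between hx hx'' hop
  refine ⟨x, hx, fun g => ?_, fun i => ?_⟩
  -- Since `x` and `g x` lie on the segments `[o, p]` and `[g o, g p]`, their distance is a maximum
  -- over four pairs of ends. The pair `p`, `g o` is the pair `o`, `g⁻¹ p` translated by `g`.
  · have key' := treeMetric_dist.dist_between ((dist_xact g x o).trans hx)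
      ((dist_xact g x p).trans hx'') ((dist_xact g o p).trans hop)
    rw [key, dist_comm o, dist_comm p, key', key']
    have h6 := h2 g⁻¹
    rw [← dist_xact_left, hN] at h6
    have h7 := dist_comm o (xact g o)
    have h8 := dist_comm o (xact g p)
    have h9 := dist_comm p (xact g p)
    exact max_le (sub_le_iff_le_add.2 (max_le (by linarith [h1 g]) (by linarith [h2 g])))
      (sub_le_iff_le_add.2 (max_le (by linarith) (by linarith [h3 g])))
  · rw [key]
    exact max_le (by linarith [h4 i]) (by linarith [h5 i])

/-- Existence of a point that satisfies a compatible family of upper bounds for its displacements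
and its distances to given centres. -/
theorem exists_dist_le {ι : Type*} (N : FreeGroup (Fin n) → ℝ) (c : ι → A.TX) (R : ι → ℝ)
    (σ : FreeGroup (Fin n) → ι → ι) (o : A.TV) (K : ℝ)
    (hN1 : N 1 = 0) (hN0 : ∀ g, 0 ≤ N g) (hN : ∀ g, N g⁻¹ = N g)
    (hNm : ∀ g h, N (g * h) ≤ N g + N h)
    (hσ : ∀ g i, c (σ g i) = xact g (c i)) (hR : ∀ g i, R (σ g i) ≤ N g + R i)
    (hc : ∀ i j, dist (c i) (c j) ≤ R i + R j)
    (hK : ∀ g, dist (vtx o) (xact g (vtx o)) ≤ N g + K) (hK' : ∀ i, dist (vtx o) (c i) ≤ R i + K) :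
    ∃ x, (∀ g, dist x (xact g x) ≤ N g) ∧ ∀ i, dist x (c i) ≤ R i := by
  let C : FreeGroup (Fin n) ⊕ ι → A.TX → ℝ :=
    Sum.elim (fun g x => dist x (xact g x) - N g) (fun i x => dist x (c i) - R i)
  suffices H : ∃ x, ∀ i, C i x ≤ 0 by
    obtain ⟨x, hx⟩ := H
    exact ⟨x, fun g => sub_nonpos.1 (hx (.inl g)), fun i => sub_nonpos.1 (hx (.inr i))⟩
  have hK0 : 0 ≤ K := by
    have := hK 1
    rwa [xact_one, dist_self, hN1, zero_add] at this
  have hR0 : ∀ i, 0 ≤ R i := fun i => by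
    have := hc i i
    rw [dist_self] at this
    linarith
  refine exists_of_approx C ?_ o K fun ε hε => ?_
  · rintro (g | i)
    · exact (continuous_id.dist (isometry_xact g).continuous).sub continuous_const
    · exact (continuous_id.dist continuous_const).sub continuous_const
  suffices H : ∃ x, dist x (vtx o) ≤ K ∧ (∀ g, dist x (xact g x) ≤ N g + ε) ∧
      ∀ i, dist x (c i) ≤ R i + ε by
    obtain ⟨x, h1, h2, h3⟩ := H
    refine ⟨x, h1, ?_⟩
    rintro (g | i)
    · exact sub_le_iff_le_add'.2 (h2 g)
    · exact sub_le_iff_le_add'.2 (h3 i)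
  set a := vtx o with ha
  -- How far `a` has to move at least: moving by `t` lowers a displacement by at most `2 * t` and
  -- the distance to a centre by at most `t`.
  let T : Set ℝ := (Set.range fun g => (dist a (xact g a) - N g) / 2) ∪
    Set.range fun i => dist a (c i) - R i
  have hT0 : (0 : ℝ) ∈ T := .inl ⟨1, by simp [xact_one, hN1]⟩
  have hTK : ∀ t ∈ T, t ≤ K := by
    rintro t (⟨g, rfl⟩ | ⟨i, rfl⟩)
    · change (dist a (xact g a) - N g) / 2 ≤ K
      linarith [hK g]
    · change dist a (c i) - R i ≤ K
      linarith [hK' i]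
  -- The supremum need not be attained. The margin is `ε / 2` because violations of displacement
  -- bounds are halved in `T`.
  obtain ⟨t, ht, ht0, hmax⟩ : ∃ t ∈ T, 0 ≤ t ∧ ∀ t' ∈ T, t' ≤ t + ε / 2 := by
    obtain ⟨t, ht, hlt⟩ := exists_lt_of_lt_csSup ⟨0, hT0⟩ (sub_lt_self (sSup T) (half_pos hε))
    have hb : ∀ t' ∈ T, t' ≤ t + ε / 2 := fun t' ht' => by
      have := le_csSup ⟨K, hTK⟩ ht'
      linarith
    rcases le_total 0 t with h | h
    · exact ⟨t, ht, h, hb⟩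
    · exact ⟨0, hT0, le_rfl, fun t' ht' => (hb t' ht').trans (by linarith)⟩
  have m1 : ∀ g, dist a (xact g a) ≤ N g + 2 * t + ε := fun g => by
    have := hmax _ (.inl ⟨g, rfl⟩)
    simp only at this
    linarith
  have m2 : ∀ i, dist a (c i) ≤ R i + t + ε := fun i => by
    have := hmax _ (.inr ⟨i, rfl⟩)
    simp only at this
    linarith
  have fin : ∀ p s, 0 ≤ s → dist a p = t + s →
      (∀ g, dist a (xact g p) ≤ N g + t + s + ε) →
      (∀ g, dist p (xact g p) ≤ N g + 2 * s + ε) → (∀ i, dist p (c i) ≤ R i + s + ε) →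
      ∃ x, dist x a ≤ K ∧ (∀ g, dist x (xact g x) ≤ N g + ε) ∧ ∀ i, dist x (c i) ≤ R i + ε :=
    fun p s hs hp h2 h3 h5 => by
      obtain ⟨x, hx, hx1, hx2⟩ := exists_displaced_le ht0 hs hp hN m1 h2 h3 m2 h5
      exact ⟨x, hx.trans_le (hTK t ht), hx1, hx2⟩
  -- The point moves by `t` towards the cause of the nearly worst violation, which is `h a` or a
  -- centre `c j`. At that far end the other constraints are controlled by subadditivity of `N`, its
  -- bound on `R`, and, for two centres, by `hc`.
  rcases ht with ⟨h, rfl⟩ | ⟨j, rfl⟩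
  · simp only at *
    refine fin (xact h a) ((dist a (xact h a) - N h) / 2 + N h)
      (add_nonneg ht0 (hN0 h)) (by ring) (fun g => ?_) (fun g => ?_) fun i => ?_
    · rw [← xact_mul]
      linarith [m1 (g * h), hNm g h]
    · rw [dist_xact_left, ← xact_mul, ← xact_mul]
      linarith [m1 (h⁻¹ * g * h), hNm h⁻¹ g, hNm (h⁻¹ * g) h, hN h]
    · rw [dist_xact_left, ← hσ]
      linarith [m2 (σ h⁻¹ i), hR h⁻¹ i, hN h]
  · simp only at *
    refine fin (c j) (R j) (hR0 j) (by ring) (fun g => ?_) (fun g => ?_) fun i => ?_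
    · rw [← hσ]
      linarith [m2 (σ g j), hR g j]
    · rw [← hσ]
      linarith [hc j (σ g j), hR g j]
    · linarith [hc j i]

/-- The displacements of `g` and its square at a single vertex `o` thus bound the displacement of
every vertex, hence the translation length, from below. -/
theorem tdist_sq_le (g : FreeGroup (Fin n)) (o y : A.TV) :
    tdist o (act g (act g o)) ≤ tdist o (act g o) + tdist y (act g y) := by
  have T := treeMetric_tdist (A := A)
  have h1 := T.four o (act g (act g o)) (act g o) (act g y)
  rw [tdist_act, tdist_act, T.symm (act g (act g o)) (act g o), tdist_act] at h1
  have h2 := T.triangle o y (act g y)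
  have h3 := T.triangle (act g o) (act g y) y
  rw [tdist_act, T.symm (act g y)] at h3
  rcases le_max_iff.1 h1 with h | h <;> linarith

/-- With `a` the correcting factor of `g` for `B`, the displacement of `g` in `B` is at most `l_B(g
a) ≤ l_A(g a)`, and `a` changes displacements in `A` by a bounded amount. This is the only use of
the domination of translation lengths in constructing the map. -/
theorem exists_displacement_bound
    (hl : ∀ w, B.translationLength w ≤ A.translationLength w) (v : A.V) :
    ∃ K, ∀ g, tdist ((1, B.base) : B.TV) (act g (1, B.base)) ≤
      tdist ((1, v) : A.TV) (act g (1, v)) + K := by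
  obtain ⟨S, hS, h⟩ := exists_finite_correction B
  obtain ⟨K, hK⟩ := (hS.image fun a => tdist ((1, v) : A.TV) (act a (1, v))).bddAbove
  refine ⟨K, fun g => ?_⟩
  obtain ⟨a, ha, hle⟩ := h g
  have h1 : tdist ((1, v) : A.TV) (act a (1, v)) ≤ K := hK ⟨a, ha, rfl⟩
  have h2 := le_translationLength (A := B) (g * a) (r :=
      tdist ((1, B.base) : B.TV) (act (g * a) (act (g * a) (1, B.base))) -
      tdist ((1, B.base) : B.TV) (act (g * a) (1, B.base)))
      fun y => by linarith [tdist_sq_le (g * a) ((1, B.base) : B.TV) y]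
  have h3 := translationLength_le (g * a) ((1, v) : A.TV)
  have h4 := treeMetric_tdist.triangle ((1, v) : A.TV) (act g (1, v)) (act (g * a) (1, v))
  rw [act_mul, tdist_act, ← act_mul] at h4
  linarith [hl (g * a)]

/-- If translation lengths do not increase then there is an equivariant map between the covering
trees that does not increase distances. -/
theorem exists_lipschitz (hl : ∀ w, B.translationLength w ≤ A.translationLength w) :
    ∃ x : A.V → B.TX, ∀ u v g, dist (x u) (xact g (x v)) ≤ tdist ((1, u) : A.TV) (g, v) := by
  classical
  have T := treeMetric_tdist (A := A)
  have := Fintype.ofFinite A.V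
  suffices H : ∀ S : Finset A.V, ∃ x : A.V → B.TX, ∀ u ∈ S, ∀ v ∈ S, ∀ g,
      dist (x u) (xact g (x v)) ≤ tdist ((1, u) : A.TV) (g, v) by
    obtain ⟨x, hx⟩ := H Finset.univ
    exact ⟨x, fun u v g => hx u (Finset.mem_univ _) v (Finset.mem_univ _) g⟩
  intro S
  -- `x v` is the image of `(1, v)`; equivariance determines the rest of its orbit.
  induction S using Finset.induction_on with
  | empty => exact ⟨fun _ => vtx (1, B.base), fun u hu => absurd hu (Finset.notMem_empty u)⟩
  | insert a S ha ih =>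
    obtain ⟨x, hx⟩ := ih
    obtain ⟨K, hK⟩ := exists_displacement_bound hl a
    have hact : ∀ (g : FreeGroup (Fin n)) (v : A.V), act g ((1, v) : A.TV) = (g, v) :=
      fun g v => by simp [act]
    have hact' : ∀ (g h : FreeGroup (Fin n)) (v : A.V), act g ((h, v) : A.TV) = (g * h, v) :=
      fun g h v => rfl
    have hinv : ∀ (g h : FreeGroup (Fin n)) (u v : A.V),
        tdist ((g, u) : A.TV) (g * h, v) = tdist ((1, u) : A.TV) (h, v) := fun g h u v => by
      rw [← hact g u, ← hact' g h v, tdist_act]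
    let o : B.TV := (1, B.base)
    let L : A.V → ℝ := fun v => dist (vtx o) (x v) + tdist ((1, v) : A.TV) (1, a)
    have hL0 : ∀ v, 0 ≤ L v := fun v => add_nonneg dist_nonneg (T.nonneg _ _)
    have hLs : ∀ v, L v ≤ ∑ v, L v := fun v =>
      Finset.single_le_sum (fun v _ => hL0 v) (Finset.mem_univ v)
    -- The displacement bounds control the orbit of `a` against itself, the balls control it against
    -- the orbits already placed. The sum of the `L v` makes the initial violation bounded uniformly
    -- over these orbits.
    obtain ⟨p, hp1, hp2⟩ := exists_dist_le (A := B) (ι := FreeGroup (Fin n) × S)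
      (fun g => tdist ((1, a) : A.TV) (g, a)) (fun i => xact i.1 (x i.2))
      (fun i => tdist ((1, a) : A.TV) (i.1, i.2.1)) (fun g i => (g * i.1, i.2)) o
      (K + ∑ v, L v) (T.self _) (fun g => T.nonneg _ _)
      (fun g => by
        have := hinv g g⁻¹ a a
        rw [mul_inv_cancel] at this
        rw [← this, T.symm])
      (fun g h => (T.triangle _ (g, a) _).trans_eq (by rw [hinv]))
      (fun g i => xact_mul _ _ _)
      (fun g i => (T.triangle _ (g, a) _).trans_eq (by rw [hinv]))
      (fun i j => by
        have h1 := hx i.2 i.2.2 j.2 j.2.2 (i.1⁻¹ * j.1)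
        have h2 := hinv i.1 (i.1⁻¹ * j.1) i.2 j.2
        rw [mul_inv_cancel_left] at h2
        rw [dist_xact_left, ← xact_mul]
        have h3 := T.triangle (i.1, i.2.1) ((1, a) : A.TV) (j.1, j.2.1)
        rw [T.symm (i.1, i.2.1) (1, a)] at h3
        linarith)
      (fun g => by
        have := hK g
        rw [hact] at this
        rw [xact_vtx, dist_vtx]
        linarith [Finset.sum_nonneg fun v (_ : v ∈ Finset.univ) => hL0 v])
      (fun i => by
        have h1 := hK i.1
        rw [hact] at h1
        have h2 := dist_triangle (vtx o) (xact i.1 (vtx o)) (xact i.1 (x i.2))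
        rw [dist_xact, xact_vtx, dist_vtx] at h2
        have h3 := T.triangle ((1, a) : A.TV) (i.1, i.2.1) (i.1, a)
        have h4 := hinv i.1 1 i.2 a
        rw [mul_one] at h4
        have h5 := hLs i.2
        have h6 : L i.2 = dist (vtx o) (x i.2) + tdist ((1, i.2) : A.TV) (1, a) := rfl
        linarith)
    refine ⟨Function.update x a p, ?_⟩
    have hne : ∀ v ∈ S, v ≠ a := fun v hv h => ha (h ▸ hv)
    intro u hu v hv g
    rcases Finset.mem_insert.1 hu with rfl | hu'
    · rw [Function.update_self]
      rcases Finset.mem_insert.1 hv with rfl | hv'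
      · rw [Function.update_self]
        exact hp1 g
      · rw [Function.update_of_ne (hne v hv')]
        exact hp2 (g, ⟨v, hv'⟩)
    · rw [Function.update_of_ne (hne u hu')]
      rcases Finset.mem_insert.1 hv with rfl | hv'
      · rw [Function.update_self, dist_comm, dist_xact_left]
        refine (hp2 (g⁻¹, ⟨u, hu'⟩)).trans_eq ?_
        have := hinv g g⁻¹ v u
        rw [mul_inv_cancel] at this
        rw [← this, T.symm]
      · rw [Function.update_of_ne (hne v hv')]
        exact hx u hu' v hv' g

end MarkedMetricGraph

/-! ### Total variation, volume and the case of equality -/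

namespace MarkedMetricGraph

open scoped ENNReal

variable {n : ℕ} {A B : MarkedMetricGraph n}

theorem tsum_tpos_le (x y : A.TX) :
    ∑' e, ENNReal.ofReal |tpos e x - tpos e y| ≤ ENNReal.ofReal (2 * dist x y) := by
  rw [ENNReal.tsum_eq_iSup_sum]
  refine iSup_le fun S => ?_
  rw [← ENNReal.ofReal_sum_of_nonneg fun _ _ => abs_nonneg _]
  exact ENNReal.ofReal_le_ofReal (sum_tpos_le S x y)

/-- The oriented edges of the geodesic between two vertices. -/
theorem exists_geodesic_edges (z y : A.TV) : ∃ P : Finset A.TE,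
    (∀ s : A.TV → ℝ, ∑ a ∈ P, (s (etgt a) - s (esrc a)) = s y - s z) ∧
    (∀ a ∈ P, tdist z (esrc a) < tdist z (etgt a)) ∧
    (∀ a ∈ P, ∀ b ∈ P, esrc a = esrc b → a = b) ∧
    (∀ a ∈ P, ∀ b ∈ P, etgt a = etgt b → a = b) ∧
    ∀ a ∈ P, tdist z (etgt a) ≤ tdist z y := by
  classical
  refine tdist_induction z (motive := fun y => ∃ P : Finset A.TE,
    (∀ s : A.TV → ℝ, ∑ a ∈ P, (s (etgt a) - s (esrc a)) = s y - s z) ∧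
    (∀ a ∈ P, tdist z (esrc a) < tdist z (etgt a)) ∧
    (∀ a ∈ P, ∀ b ∈ P, esrc a = esrc b → a = b) ∧
    (∀ a ∈ P, ∀ b ∈ P, etgt a = etgt b → a = b) ∧
    ∀ a ∈ P, tdist z (etgt a) ≤ tdist z y) ⟨∅, by simp⟩ ?_ y
  rintro e he ⟨P, h1, h2, h3, h4, h5⟩
  have hpos := elen_pos e
  have hsrc : ∀ a ∈ P, esrc a ≠ esrc e := fun a ha h => by
    have := h2 a ha
    have := h5 a ha
    rw [h] at *
    linarith
  have htgt : ∀ a ∈ P, etgt a ≠ etgt e := fun a ha h => by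
    have := h5 a ha
    rw [h] at this
    linarith
  have hnot : e ∉ P := fun h => hsrc e h rfl
  refine ⟨insert e P, fun s => ?_, fun a ha => ?_, fun a ha b hb h => ?_, fun a ha b hb h => ?_,
    fun a ha => ?_⟩
  · rw [Finset.sum_insert hnot, h1]
    ring
  · rcases Finset.mem_insert.1 ha with rfl | ha
    · linarith
    · exact h2 a ha
  · rcases Finset.mem_insert.1 ha with rfl | ha' <;> rcases Finset.mem_insert.1 hb with rfl | hb'
    · rfl
    · exact absurd h.symm (hsrc b hb')
    · exact absurd h (hsrc a ha')
    · exact h3 a ha' b hb' h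
  · rcases Finset.mem_insert.1 ha with rfl | ha' <;> rcases Finset.mem_insert.1 hb with rfl | hb'
    · rfl
    · exact absurd h.symm (htgt b hb')
    · exact absurd h (htgt a ha')
    · exact h4 a ha' b hb' h
  · rcases Finset.mem_insert.1 ha with rfl | ha
    · exact le_rfl
    · linarith [h5 a ha]

theorem sum_union_erev [DecidableEq A.TE] {P : Finset A.TE} {z : A.TV}
    (h : ∀ a ∈ P, tdist z (esrc a) < tdist z (etgt a)) (s : A.TV → ℝ) :
    ∑ a ∈ P ∪ P.image erev, |s (esrc a) - s (etgt a)| = 2 * ∑ a ∈ P, |s (esrc a) - s (etgt a)| := by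
  rw [Finset.sum_union, Finset.sum_image, two_mul]
  · congr 1
    refine Finset.sum_congr rfl fun a _ => ?_
    rw [esrc_erev, etgt_erev, abs_sub_comm]
  · intro a _ b _ hab
    rw [← erev_erev a, hab, erev_erev]
  · rw [Finset.disjoint_left]
    intro a ha hb
    obtain ⟨b, hb', rfl⟩ := Finset.mem_image.1 hb
    have h1 := h _ ha
    rw [esrc_erev, etgt_erev] at h1
    exact lt_asymm h1 (h b hb')

/-- The increments telescope along the geodesic from `z` to `y`, and each of its edges occurs in
both orientations. -/
theorem two_mul_le_tsum_variation (s : A.TV → ℝ) (z y : A.TV) :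
    ENNReal.ofReal (2 * (s y - s z)) ≤ ∑' a : A.TE, ENNReal.ofReal |s (esrc a) - s (etgt a)| := by
  classical
  obtain ⟨P, h1, h2, -⟩ := exists_geodesic_edges z y
  refine le_trans ?_ (ENNReal.sum_le_tsum (P ∪ P.image erev))
  rw [← ENNReal.ofReal_sum_of_nonneg fun _ _ => abs_nonneg _, sum_union_erev h2, ← h1]
  refine ENNReal.ofReal_le_ofReal ?_
  gcongr
  rw [abs_sub_comm]
  exact le_abs_self _

/-- A function on the vertices whose total variation is minimal does not fold edges. -/
theorem abs_sub_eq_of_variation_le {s : A.TV → ℝ} {z y : A.TV}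
    (H : ∀ S : Finset A.TE, ∑ a ∈ S, |s (esrc a) - s (etgt a)| ≤ 2 * (s y - s z)) {a b : A.TE}
    (hab : a ≠ b) (hs : esrc a = esrc b) :
    |s (etgt a) - s (etgt b)| = |s (etgt a) - s (esrc a)| + |s (etgt b) - s (esrc a)| := by
  classical
  obtain ⟨P, h1, h2, h3, h4, -⟩ := exists_geodesic_edges z y
  -- A decrease along the geodesic, or any variation away from it as in `hout`, would push the total
  -- variation above the assumed bound.
  have hle : ∀ c ∈ P, s (esrc c) ≤ s (etgt c) := fun c hc => by
    by_contra hlt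
    have := H (P ∪ P.image erev)
    rw [sum_union_erev h2, ← h1] at this
    have hlt' : ∑ a ∈ P, (s (etgt a) - s (esrc a)) < ∑ a ∈ P, |s (esrc a) - s (etgt a)| := by
      refine Finset.sum_lt_sum (fun a _ => ?_) ⟨c, hc, ?_⟩
      · rw [abs_sub_comm]
        exact le_abs_self _
      · rw [abs_of_pos (by linarith)]
        linarith
    linarith
  have hout : ∀ c, s (esrc c) ≠ s (etgt c) → c ∈ P ∨ erev c ∈ P := fun c hc => by
    by_contra hn
    push Not at hn
    have hc' : c ∉ P ∪ P.image erev := fun h => by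
      rcases Finset.mem_union.1 h with h | h
      · exact hn.1 h
      · obtain ⟨d, hd, rfl⟩ := Finset.mem_image.1 h
        rw [erev_erev] at hn
        exact hn.2 hd
    have := H (insert c (P ∪ P.image erev))
    rw [Finset.sum_insert hc', sum_union_erev h2, ← h1] at this
    have hlt' : ∑ a ∈ P, (s (etgt a) - s (esrc a)) ≤ ∑ a ∈ P, |s (esrc a) - s (etgt a)| := by
      refine Finset.sum_le_sum fun a _ => ?_
      rw [abs_sub_comm]
      exact le_abs_self _
    linarith [abs_pos.2 (sub_ne_zero.2 hc)]
  have hup : ∀ c, s (esrc c) < s (etgt c) → c ∈ P := fun c hc => by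
    rcases hout c hc.ne with h | h
    · exact h
    · have := hle _ h
      rw [esrc_erev, etgt_erev] at this
      linarith
  have hdown : ∀ c, s (etgt c) < s (esrc c) → erev c ∈ P := fun c hc =>
    hup _ (by rwa [esrc_erev, etgt_erev])
  -- Rising edges lie on the geodesic and so do the reverses of falling ones. The geodesic leaves
  -- and enters each vertex at most once, so `a` and `b` cannot both rise or both fall.
  rcases lt_trichotomy (s (etgt a)) (s (esrc a)) with ha | ha | ha <;>
    rcases lt_trichotomy (s (etgt b)) (s (esrc b)) with hb | hb | hb <;> rw [← hs] at hb
  · have := h4 _ (hdown a ha) _ (hdown b (hs ▸ hb)) (by rw [etgt_erev, etgt_erev, hs])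
    exact absurd (by rw [← erev_erev a, this, erev_erev]) hab
  · rw [hb, sub_self, abs_zero, add_zero]
  · rw [abs_of_neg (by linarith), abs_of_neg (by linarith), abs_of_pos (by linarith)]
    ring
  · rw [ha, sub_self, abs_zero, zero_add, abs_sub_comm]
  · rw [ha, hb, sub_self, abs_zero, zero_add]
  · rw [ha, sub_self, abs_zero, zero_add, abs_sub_comm]
  · rw [abs_of_pos (by linarith), abs_of_pos (by linarith), abs_of_neg (by linarith)]
    ring
  · rw [hb, sub_self, abs_zero, add_zero]
  · exact absurd (h3 _ (hup a ha) _ (hup b (hs ▸ hb)) hs) hab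

/-- An equivariant map between covering trees, given on vertices, that does not increase
distances. -/
structure TreeMap (A B : MarkedMetricGraph n) where
  toFun : A.TV → B.TX
  map_act : ∀ g y, toFun (act g y) = xact g (toFun y)
  dist_le : ∀ y z, dist (toFun y) (toFun z) ≤ tdist y z

theorem exists_treeMap (hl : ∀ w, B.translationLength w ≤ A.translationLength w) :
    Nonempty (TreeMap A B) := by
  obtain ⟨x, hx⟩ := exists_lipschitz hl
  refine ⟨⟨fun y => xact y.1 (x y.2), fun g y => xact_mul _ _ _, fun y z => ?_⟩⟩
  rw [dist_xact_left, ← xact_mul]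
  refine (hx _ _ _).trans_eq ?_
  rw [← tdist_act y.1]
  simp [act]

namespace TreeMap

variable (f : TreeMap A B)

/-- The variation of the projection to an edge of `B` along an edge of `A`. -/
def variation (a : A.TE) (e : B.TE) : ℝ≥0∞ :=
  ENNReal.ofReal |tpos e (f.toFun (esrc a)) - tpos e (f.toFun (etgt a))|

theorem variation_eact (g : FreeGroup (Fin n)) (a : A.TE) (e : B.TE) :
    f.variation (eact g a) (eact g e) = f.variation a e := by
  unfold variation
  rw [esrc_eact, etgt_eact, f.map_act, f.map_act, tpos_xact, tpos_xact]

theorem tsum_variation_left_eact (g : FreeGroup (Fin n)) (e : B.TE) :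
    ∑' a, f.variation a (eact g e) = ∑' a, f.variation a e := by
  let φ : A.TE ≃ A.TE := (Equiv.mulLeft g).prodCongr (Equiv.refl _)
  rw [← φ.tsum_eq]
  exact tsum_congr fun a => f.variation_eact g a e

theorem tsum_variation_right_eact (g : FreeGroup (Fin n)) (a : A.TE) :
    ∑' e, f.variation (eact g a) e = ∑' e, f.variation a e := by
  let φ : B.TE ≃ B.TE := (Equiv.mulLeft g).prodCongr (Equiv.refl _)
  rw [← φ.tsum_eq]
  exact tsum_congr fun e => f.variation_eact g a e

/-- Unfolding: the variation is invariant under the diagonal action, so orbits of pairs of edges may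
be represented with either member in its fundamental domain. Values in `ℝ≥0∞` let the sums be
exchanged freely. -/
theorem sum_tsum_variation :
    ∑ d : B.D, ∑' a : A.TE, f.variation a (1, d) =
      ∑ c : A.D, ∑' e : B.TE, f.variation (1, c) e := by
  have h : ∀ (g : FreeGroup (Fin n)) (c : A.D) (d : B.D),
      f.variation (g, c) (1, d) = f.variation (1, c) (g⁻¹, d) := fun g c d => by
    rw [← f.variation_eact g⁻¹]
    simp [eact]
  simp_rw [ENNReal.tsum_prod', tsum_fintype, h]
  have h2 : ∀ c : A.D, ∑' g : FreeGroup (Fin n), ∑ d : B.D, f.variation (1, c) (g, d) =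
      ∑' g : FreeGroup (Fin n), ∑ d : B.D, f.variation (1, c) (g⁻¹, d) := fun c =>
    ((Equiv.inv (FreeGroup (Fin n))).tsum_eq
      fun g => ∑ d : B.D, f.variation (1, c) (g, d)).symm
  simp_rw [h2, ← tsum_fintype (L := .unconditional _)]
  rw [ENNReal.tsum_comm]
  rw [ENNReal.tsum_comm (α := A.D)]
  exact tsum_congr fun g => ENNReal.tsum_comm

theorem exists_tpos_zero (e : B.TE) : ∃ z, tpos e (f.toFun z) = 0 := by
  obtain ⟨g, hg⟩ := exists_tpos_eq (erev e) (f.toFun (1, A.base))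
  refine ⟨act g (1, A.base), ?_⟩
  rw [tpos_erev, elen_erev] at hg
  rw [f.map_act]
  linarith

theorem exists_tpos_elen (e : B.TE) : ∃ z, tpos e (f.toFun z) = elen e := by
  obtain ⟨g, hg⟩ := exists_tpos_eq e (f.toFun (1, A.base))
  exact ⟨act g (1, A.base), by rw [f.map_act, hg]⟩

/-- Orbits reach both sides of `e`, so the projection to `e` takes both extreme values on the image.
-/
theorem le_tsum_variation (e : B.TE) :
    ENNReal.ofReal (2 * elen e) ≤ ∑' a, f.variation a e := by
  obtain ⟨z, hz⟩ := f.exists_tpos_zero e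
  obtain ⟨y, hy⟩ := f.exists_tpos_elen e
  have := two_mul_le_tsum_variation (fun v => tpos e (f.toFun v)) z y
  simp only [hz, hy, sub_zero] at this
  exact this

theorem tsum_variation_le (a : A.TE) :
    ∑' e, f.variation a e ≤ ENNReal.ofReal (2 * elen a) := by
  refine (tsum_tpos_le _ _).trans (ENNReal.ofReal_le_ofReal ?_)
  have := f.dist_le (esrc a) (etgt a)
  rw [tdist_edge] at this
  linarith

theorem sum_ofReal_len (C : MarkedMetricGraph n) :
    ∑ d : C.D, ENNReal.ofReal (2 * C.len d) = ENNReal.ofReal (4 * C.volume) := by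
  rw [← ENNReal.ofReal_sum_of_nonneg fun d _ => mul_nonneg zero_le_two (C.len_pos d).le,
    ← Finset.mul_sum]
  congr 1
  unfold volume
  ring

/-- The volume does not increase. -/
theorem volume_le (f : TreeMap A B) : B.volume ≤ A.volume := by
  -- One factor two comes from summing over both orientations, the other from the variation, which
  -- also counts both orientations.
  have h : ENNReal.ofReal (4 * B.volume) ≤ ENNReal.ofReal (4 * A.volume) := by
    rw [← sum_ofReal_len, ← sum_ofReal_len]
    calc ∑ d : B.D, ENNReal.ofReal (2 * B.len d)
        ≤ ∑ d : B.D, ∑' a : A.TE, f.variation a (1, d) :=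
          Finset.sum_le_sum fun d _ => f.le_tsum_variation (1, d)
      _ = ∑ c : A.D, ∑' e : B.TE, f.variation (1, c) e := f.sum_tsum_variation
      _ ≤ ∑ d : A.D, ENNReal.ofReal (2 * A.len d) :=
          Finset.sum_le_sum fun d _ => f.tsum_variation_le (1, d)
  rw [ENNReal.ofReal_le_ofReal_iff (by linarith [A.volume_pos])] at h
  linarith

theorem le_of_sum_le {ι : Type*} [Fintype ι] {a b : ι → ℝ≥0∞} (h : ∀ i, b i ≤ a i)
    (hs : ∑ i, a i ≤ ∑ i, b i) (hb : ∀ i, b i ≠ ⊤) (i : ι) : a i ≤ b i := by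
  classical
  rw [← Finset.add_sum_erase _ a (Finset.mem_univ i),
    ← Finset.add_sum_erase _ b (Finset.mem_univ i)] at hs
  have h1 : a i + ∑ j ∈ Finset.univ.erase i, b j ≤ b i + ∑ j ∈ Finset.univ.erase i, b j :=
    le_trans (by gcongr; exact h _) hs
  exact (ENNReal.add_le_add_iff_right (ENNReal.sum_ne_top.2 fun j _ => hb j)).1 h1

variable {f}

/-- Equal volumes force equality throughout the chain that proves `volume_le`, hence in every term;
invariance carries this from the representatives to all edges. -/
theorem tsum_variation_left_le (hv : B.volume = A.volume) (e : B.TE) :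
    ∑' a, f.variation a e ≤ ENNReal.ofReal (2 * elen e) := by
  have h := le_of_sum_le (a := fun d : B.D => ∑' a : A.TE, f.variation a (1, d))
    (b := fun d : B.D => ENNReal.ofReal (2 * B.len d)) (fun d => f.le_tsum_variation (1, d))
    (by
      rw [sum_ofReal_len, hv, ← sum_ofReal_len, f.sum_tsum_variation]
      exact Finset.sum_le_sum fun d _ => f.tsum_variation_le (1, d))
    (fun _ => ENNReal.ofReal_ne_top) e.2
  have h1 : e = eact e.1 (1, e.2) := by simp [eact]
  rw [h1, tsum_variation_left_eact]
  exact h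

theorem le_tsum_variation_right (hv : B.volume = A.volume) (a : A.TE) :
    ENNReal.ofReal (2 * elen a) ≤ ∑' e, f.variation a e := by
  have h := le_of_sum_le (b := fun d : A.D => ∑' e : B.TE, f.variation (1, d) e)
    (a := fun d : A.D => ENNReal.ofReal (2 * A.len d)) (fun d => f.tsum_variation_le (1, d))
    (by
      rw [sum_ofReal_len, ← hv, ← sum_ofReal_len, ← f.sum_tsum_variation]
      exact Finset.sum_le_sum fun d _ => f.le_tsum_variation (1, d))
    (fun d => ne_top_of_le_ne_top ENNReal.ofReal_ne_top (f.tsum_variation_le (1, d))) a.2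
  have h1 : a = eact a.1 (1, a.2) := by simp [eact]
  rw [h1, tsum_variation_right_eact]
  exact h

theorem no_fold (hv : B.volume = A.volume) (e : B.TE) {a b : A.TE} (hab : a ≠ b) (hs : esrc a = esrc b) :
    |tpos e (f.toFun (etgt a)) - tpos e (f.toFun (etgt b))| =
      |tpos e (f.toFun (etgt a)) - tpos e (f.toFun (esrc a))| +
      |tpos e (f.toFun (etgt b)) - tpos e (f.toFun (esrc a))| := by
  obtain ⟨z, hz⟩ := f.exists_tpos_zero e
  obtain ⟨y, hy⟩ := f.exists_tpos_elen e
  refine abs_sub_eq_of_variation_le (s := fun v => tpos e (f.toFun v)) (z := z) (y := y)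
    (fun S => ?_) hab hs
  simp only [hz, hy, sub_zero]
  have h1 := (ENNReal.sum_le_tsum S).trans (tsum_variation_left_le (f := f) hv e)
  unfold variation at h1
  rw [← ENNReal.ofReal_sum_of_nonneg fun _ _ => abs_nonneg _,
    ENNReal.ofReal_le_ofReal_iff (by linarith [elen_pos e])] at h1
  exact h1

theorem dist_edge_eq (hv : B.volume = A.volume) (a : A.TE) :
    dist (f.toFun (esrc a)) (f.toFun (etgt a)) = elen a := by
  refine le_antisymm ((f.dist_le _ _).trans_eq (tdist_edge a)) ?_
  have := (le_tsum_variation_right (f := f) hv a).trans (tsum_tpos_le _ _)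
  rw [ENNReal.ofReal_le_ofReal_iff (by positivity)] at this
  linarith

/-- By `no_fold`, for every `e` the variation between the two far ends is the sum of those along the
two edges. Summed over `e` these give at least twice the two lengths, while `tsum_tpos_le` bounds
the total by twice the distance. -/
theorem le_dist_two_edges (hv : B.volume = A.volume) {a b : A.TE} (hab : a ≠ b) (hs : esrc a = esrc b) :
    elen a + elen b ≤ dist (f.toFun (etgt a)) (f.toFun (etgt b)) := by
  have h1 := tsum_tpos_le (f.toFun (etgt a)) (f.toFun (etgt b))
  have h2 : ∀ e, ENNReal.ofReal |tpos e (f.toFun (etgt a)) - tpos e (f.toFun (etgt b))| =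
      f.variation a e + f.variation b e := fun e => by
    unfold variation
    rw [no_fold hv e hab hs, ENNReal.ofReal_add (abs_nonneg _) (abs_nonneg _),
      abs_sub_comm (tpos e (f.toFun (etgt a))), abs_sub_comm (tpos e (f.toFun (etgt b))), ← hs]
  rw [tsum_congr h2, ENNReal.tsum_add] at h1
  have h3 := (add_le_add (le_tsum_variation_right (f := f) hv a)
    (le_tsum_variation_right (f := f) hv b)).trans h1
  rw [← ENNReal.ofReal_add (by linarith [elen_pos a]) (by linarith [elen_pos b]),
    ENNReal.ofReal_le_ofReal_iff (by positivity)] at h3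
  linarith

/-- A distance decreasing equivariant map between trees of equal covolume is isometric. -/
theorem dist_eq (hv : B.volume = A.volume) (z y : A.TV) : dist (f.toFun z) (f.toFun y) = tdist z y := by
  have T := treeMetric_tdist (A := A)
  refine tdist_induction z (motive := fun y => dist (f.toFun z) (f.toFun y) = tdist z y)
    (by rw [dist_self, T.self]) ?_ y
  intro e he ih
  by_cases hz : z = esrc e
  · subst hz
    rw [dist_edge_eq hv, tdist_edge]
  obtain ⟨e', h1, h2⟩ := exists_last_edge hz
  have hne : erev e' ≠ e := fun h => by
    have h3 : etgt e = esrc e' := by rw [← h, etgt_erev]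
    rw [h3] at he
    linarith [elen_pos e, elen_pos e']
  have h4 := le_dist_two_edges (f := f) hv hne h1
  rw [elen_erev, etgt_erev] at h4
  have h5 := dist_edge_eq (f := f) hv e'
  rw [h1] at h5
  have h6 := dist_edge_eq (f := f) hv e
  have h7 := f.dist_le z (esrc e')
  have h8 := f.dist_le z (etgt e)
  -- The last two edges of the geodesic are not folded; the four point condition turns this local
  -- fact into additivity along the whole geodesic.
  have h9 := treeMetric_dist.four (f.toFun z) (f.toFun (esrc e)) (f.toFun (esrc e'))
    (f.toFun (etgt e))
  rcases le_max_iff.1 h9 with h | h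
  · linarith [elen_pos e']
  · rw [dist_comm (f.toFun (esrc e))] at h
    linarith

end TreeMap

end MarkedMetricGraph

/-! ### From an isometric map of trees to an equivalence of marked graphs -/

namespace MarkedMetricGraph

variable {n : ℕ} {A B : MarkedMetricGraph n}

theorem OnEdge.erev {e : A.TE} {x : A.TX} (h : OnEdge (erev e) x) : OnEdge e x := by
  unfold OnEdge at *
  rw [esrc_erev, etgt_erev, elen_erev] at h
  linarith

/-- A point that projects to the interior of an edge lies on this edge. -/
theorem onEdge_of_tpos {e : A.TE} {x : A.TX} (h0 : 0 < tpos e x) (h1 : tpos e x < elen e) :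
    OnEdge e x := by
  obtain ⟨e', he'⟩ := exists_onEdge x
  by_cases h : e' = e
  · exact h ▸ he'
  by_cases h' : e' = erev e
  · exact (h' ▸ he').erev
  rw [he'.tpos_eq h h'] at h0 h1
  rcases tpos_vtx e (esrc e') with h2 | h2 <;> linarith

theorem OnEdge.dist_esrc {e : A.TE} {x : A.TX} (h : OnEdge e x) :
    dist x (vtx (esrc e)) = tpos e x := by
  unfold OnEdge at h
  unfold tpos
  linarith

theorem OnEdge.dist_etgt {e : A.TE} {x : A.TX} (h : OnEdge e x) :
    dist x (vtx (etgt e)) = elen e - tpos e x := by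
  unfold OnEdge at h
  unfold tpos
  linarith

/-- Points with the same projection to the interior of an edge coincide. -/
theorem dist_eq_zero_of_tpos_eq {e : A.TE} {x y : A.TX} (h0 : 0 < tpos e x)
    (h1 : tpos e x < elen e) (h : tpos e y = tpos e x) : dist x y = 0 := by
  have hx := onEdge_of_tpos h0 h1
  have hy := onEdge_of_tpos (h.symm ▸ h0) (h.symm ▸ h1)
  rw [treeMetric_dist.dist_between hx.dist_esrc hx.dist_etgt (by rw [dist_edge]; ring),
    dist_comm _ y, dist_comm _ y, hy.dist_esrc, hy.dist_etgt, h]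
  simp

theorem vtx_injective_of_dist {y z : A.TV} (h : dist (vtx y) (vtx z) = 0) : y = z :=
  eq_of_tdist_eq_zero (by rwa [dist_vtx] at h)

theorem not_lt_iff_lt_of_abs_sub_eq {a b c : ℝ} (ha : a ≠ c) (hb : b ≠ c)
    (h : |a - b| = |a - c| + |b - c|) : ¬ (a < c ↔ b < c) := by
  intro hab
  rcases lt_or_gt_of_ne ha with h1 | h1
  · have h2 := hab.1 h1
    rw [abs_of_neg (sub_neg.2 h1), abs_of_neg (sub_neg.2 h2)] at h
    rcases abs_cases (a - b) with h3 | h3 <;> linarith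
  · have h2 : c < b := lt_of_le_of_ne (not_lt.1 fun h2 => lt_asymm h1 (hab.2 h2)) hb.symm
    rw [abs_of_pos (sub_pos.2 h1), abs_of_pos (sub_pos.2 h2)] at h
    rcases abs_cases (a - b) with h3 | h3 <;> linarith

namespace TreeMap

variable {f : TreeMap A B}

/-- Vertices are mapped to vertices. -/
theorem exists_vtx (hv : B.volume = A.volume) (y : A.TV) :
    ∃ z, dist (f.toFun y) (vtx z) = 0 := by
  obtain ⟨e, he⟩ := exists_onEdge (f.toFun y)
  rcases (tpos_nonneg e (f.toFun y)).eq_or_lt with h0 | h0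
  · exact ⟨_, by rw [he.dist_esrc, ← h0]⟩
  rcases (tpos_le e (f.toFun y)).eq_or_lt with h1 | h1
  · exact ⟨_, by rw [he.dist_etgt, h1, sub_self]⟩
  exfalso
  -- An interior point of `e` has only two directions, but three pairwise unfolded edges would need
  -- three.
  obtain ⟨a, b, c, ha, hb, hc, hab, hac, hbc⟩ := exists_three_edges y.2
  have hs : ∀ d, A.src d = y.2 → esrc ((y.1, d) : A.TE) = y := fun d hd => Prod.ext rfl hd
  have hne : ∀ d, A.src d = y.2 →
      tpos e (f.toFun (etgt ((y.1, d) : A.TE))) ≠ tpos e (f.toFun y) := fun d hd h => by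
    have h2 := dist_eq_zero_of_tpos_eq h0 h1 h
    have h3 := tdist_edge ((y.1, d) : A.TE)
    rw [hs d hd, ← f.dist_eq hv, h2] at h3
    exact (elen_pos _).ne h3
  have hf : ∀ d d', A.src d = y.2 → A.src d' = y.2 → d ≠ d' →
      ¬ (tpos e (f.toFun (etgt ((y.1, d) : A.TE))) < tpos e (f.toFun y) ↔
        tpos e (f.toFun (etgt ((y.1, d') : A.TE))) < tpos e (f.toFun y)) :=
    fun d d' hd hd' hdd => by
      have := f.no_fold hv e (a := ((y.1, d) : A.TE)) (b := ((y.1, d') : A.TE))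
        (fun h => hdd (congrArg Prod.snd h)) ((hs d hd).trans (hs d' hd').symm)
      rw [hs d hd] at this
      exact not_lt_iff_lt_of_abs_sub_eq (hne d hd) (hne d' hd') this
  have h2 := hf a b ha hb hab
  have h3 := hf a c ha hc hac
  have h4 := hf b c hb hc hbc
  tauto

/-- Every vertex is the image of a vertex. -/
theorem exists_dist_eq_zero (hv : B.volume = A.volume) (y : B.TV) :
    ∃ z, dist (f.toFun z) (vtx y) = 0 := by
  obtain ⟨a, b, c, ha, hb, hc, hab, hac, hbc⟩ := exists_three_edges y.2
  have hs : ∀ d, B.src d = y.2 → esrc ((y.1, d) : B.TE) = y := fun d hd => Prod.ext rfl hd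
  -- The images of `w a`, `w b`, `w c` lie beyond three different edges at `y`, so each two of them
  -- have `y` between them and their median is `y`. As `f` is isometric, the median of `w a`, `w b`,
  -- `w c` is mapped there.
  choose w hw using fun d => f.exists_tpos_elen ((y.1, d) : B.TE)
  have hsep : ∀ d d', B.src d = y.2 → B.src d' = y.2 → d ≠ d' →
      dist (f.toFun (w d)) (f.toFun (w d')) =
        dist (f.toFun (w d)) (vtx y) + dist (f.toFun (w d')) (vtx y) := fun d d' hd hd' hdd => by
    have e1 := hs d hd
    have e2 := hs d' hd'
    have h1 := hw d
    have h2 := hw d'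
    apply le_antisymm (dist_triangle_right _ _ _)
    have h3 : tpos ((y.1, d) : B.TE) (f.toFun (w d')) = 0 := by
      rcases (tpos_nonneg ((y.1, d) : B.TE) (f.toFun (w d'))).eq_or_lt with h0 | h0
      · exact h0.symm
      exfalso
      have hne : ((y.1, d') : B.TE) ≠ (y.1, d) := fun h => hdd (congrArg Prod.snd h).symm
      have hne' : ((y.1, d') : B.TE) ≠ erev (y.1, d) := fun h => by
        have h5 := elen_pos ((y.1, d) : B.TE)
        rw [← tdist_edge, ← esrc_erev, ← h, e1, e2, treeMetric_tdist.self] at h5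
        exact lt_irrefl _ h5
      have h5 : tpos ((y.1, d) : B.TE) (vtx (etgt ((y.1, d') : B.TE))) = 0 := by
        have h6 := dist_edge ((y.1, d) : B.TE)
        rw [e1] at h6
        rw [← tpos_esrc_eq_etgt hne hne', e2]
        unfold tpos
        rw [e1, dist_self, h6]
        ring
      have h6 := le_dist_of_tpos_lt (h5.trans_lt h0)
      unfold tpos at h2 h5 h6 h0
      rw [e1] at h5 h6 h0
      rw [e2] at h2
      have h8 := dist_edge ((y.1, d') : B.TE)
      rw [e2, dist_comm] at h8
      have h9 := dist_comm (f.toFun (w d')) (vtx (etgt ((y.1, d') : B.TE)))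
      have h10 := elen_pos ((y.1, d') : B.TE)
      linarith
    have h4 := le_dist_of_tpos_lt (e := (y.1, d)) (x := f.toFun (w d')) (y := f.toFun (w d))
      (by rw [h3, h1]; exact elen_pos _)
    rw [h1, h3, e1] at h4
    linarith [dist_comm (f.toFun (w d')) (f.toFun (w d))]
  obtain ⟨m, m1, m2, m3⟩ := exists_median (w a) (w b) (w c)
  refine ⟨m, le_antisymm ?_ dist_nonneg⟩
  have s1 := hsep a b ha hb hab
  have s2 := hsep a c ha hc hac
  have s3 := hsep b c hb hc hbc
  rw [← f.dist_eq hv, ← f.dist_eq hv, ← f.dist_eq hv] at m1 m2 m3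
  have h4 := treeMetric_dist.four (f.toFun m) (vtx y) (f.toFun (w a)) (f.toFun (w b))
  have c1 := dist_comm (f.toFun m) (f.toFun (w a))
  have c2 := dist_comm (f.toFun m) (f.toFun (w b))
  have c3 := dist_comm (vtx y) (f.toFun (w a))
  have c4 := dist_comm (vtx y) (f.toFun (w b))
  rcases le_max_iff.1 h4 with h | h <;> linarith

/-- Covering trees of equal covolume related by a distance decreasing equivariant map are
equivariantly isometric. -/
theorem exists_equiv (f : TreeMap A B) (hv : B.volume = A.volume) :
    ∃ β : A.TV ≃ B.TV, (∀ y z, tdist (β y) (β z) = tdist y z) ∧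
      ∀ g y, β (act g y) = act g (β y) := by
  choose β hβ using f.exists_vtx hv
  have hdist : ∀ y z, tdist (β y) (β z) = tdist y z := fun y z => by
    have h1 := dist_triangle4 (vtx (β y)) (f.toFun y) (f.toFun z) (vtx (β z))
    have h2 := dist_triangle4 (f.toFun y) (vtx (β y)) (vtx (β z)) (f.toFun z)
    rw [dist_comm _ (f.toFun y), hβ, hβ] at h1
    rw [dist_comm (vtx (β z)), hβ, hβ] at h2
    rw [← f.dist_eq hv, ← dist_vtx]
    linarith
  have hbij : Function.Bijective β := by
    constructor
    · intro y z h
      refine eq_of_tdist_eq_zero ?_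
      rw [← hdist, h, treeMetric_tdist.self]
    · intro y
      obtain ⟨z, hz⟩ := f.exists_dist_eq_zero hv y
      refine ⟨z, vtx_injective_of_dist (le_antisymm ?_ dist_nonneg)⟩
      refine (dist_triangle_left _ _ (f.toFun z)).trans ?_
      rw [hβ, hz, add_zero]
  refine ⟨Equiv.ofBijective β hbij, hdist, fun g y => ?_⟩
  change β (act g y) = act g (β y)
  refine vtx_injective_of_dist (le_antisymm ?_ dist_nonneg)
  refine (dist_triangle_left _ _ (f.toFun (act g y))).trans_eq ?_
  rw [hβ, ← xact_vtx, f.map_act, dist_xact, hβ, add_zero]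

end TreeMap

/-- An isometry between the sets of vertices preserves adjacency. -/
theorem exists_edge_of_isometry (β : A.TV ≃ B.TV) (hβ : ∀ y z, tdist (β y) (β z) = tdist y z)
    (a : A.TE) : ∃ e : B.TE, esrc e = β (esrc a) ∧ etgt e = β (etgt a) := by
  have hne : β (esrc a) ≠ β (etgt a) := fun h => by
    have := tdist_edge a
    rw [β.injective h, treeMetric_tdist.self] at this
    exact (elen_pos a).ne this
  obtain ⟨e, h1, h2⟩ := exists_first_edge hne
  refine ⟨e, h1, ?_⟩
  have h3 := tdist_edge e
  rw [h1, ← β.apply_symm_apply (etgt e), hβ] at h3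
  rw [← β.apply_symm_apply (etgt e), hβ, hβ, tdist_edge] at h2
  -- No vertex lies strictly between the ends of `a`. The preimage of `etgt e` lies on that segment
  -- and is not the source, since `e` has positive length.
  have h4 := tdist_edge_cases (β.symm (etgt e)) a
  have h5 := treeMetric_tdist.symm (β.symm (etgt e)) (esrc a)
  have h6 := elen_pos e
  rcases h4 with h4 | h4
  · linarith
  · rw [← eq_of_tdist_eq_zero (x := β.symm (etgt e)) (y := etgt a) (by linarith),
      β.apply_symm_apply]

/-- An equivariant isometry between the covering trees induces an equivalence of marked graphs. -/
theorem equivalent_of_isometry (β : A.TV ≃ B.TV) (hβ : ∀ y z, tdist (β y) (β z) = tdist y z)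
    (hact : ∀ g y, β (act g y) = act g (β y)) : Equivalent A B := by
  have hpair : ∀ y : A.TV, y = act y.1 (1, y.2) := fun y => by simp [act]
  -- `ed d` is the image of the lift of `d` at `1`; forgetting the group coordinate gives the map of
  -- graphs.
  choose ed hsrc htgt using fun d : A.D => exists_edge_of_isometry β hβ (1, d)
  have hsrc' : ∀ d, esrc (ed d) = β (1, A.src d) := hsrc
  have hV : Function.Bijective fun v : A.V => (β (1, v)).2 := by
    constructor
    · intro u v h
      have h1 : β (1, u) = β (act ((β (1, u)).1 * ((β (1, v)).1)⁻¹) (1, v)) := by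
        rw [hact]
        exact Prod.ext (by simp [act]) h
      exact congrArg Prod.snd (β.injective h1)
    · intro v
      obtain ⟨y, hy⟩ := β.surjective (1, v)
      refine ⟨y.2, ?_⟩
      rw [hpair y, hact] at hy
      exact congrArg Prod.snd hy
  have hsV : ∀ d, B.src (ed d).2 = (β (1, A.src d)).2 := fun d => congrArg Prod.snd (hsrc' d)
  have hD : Function.Bijective fun d : A.D => (ed d).2 := by
    constructor
    · intro d d' h
      have h1 : A.src d = A.src d' := hV.1 (by
        change (β (1, A.src d)).2 = (β (1, A.src d')).2
        change (ed d).2 = (ed d').2 at h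
        rw [← hsV, ← hsV, h])
      have h2 : ed d = ed d' := by
        have h3 : esrc (ed d) = esrc (ed d') := by rw [hsrc', hsrc', h1]
        have h4 : (esrc (ed d)).1 = (esrc (ed d')).1 := congrArg Prod.fst h3
        exact Prod.ext h4 h
      have h3 : ((1, d) : A.TE) = (1, d') :=
        edge_unique (Prod.ext rfl h1) (β.injective (by rw [← htgt, ← htgt, h2]))
      exact congrArg Prod.snd h3
    · intro e
      obtain ⟨u, hu⟩ := hV.2 (B.src e)
      have h1 : esrc (((β (1, u)).1, e) : B.TE) = β (1, u) := Prod.ext rfl hu.symm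
      obtain ⟨a, ha, ha'⟩ := exists_edge_of_isometry β.symm
        (fun y z => by rw [← hβ, β.apply_symm_apply, β.apply_symm_apply])
        (((β (1, u)).1, e) : B.TE)
      rw [h1, β.symm_apply_apply] at ha
      have h2 : a = (1, a.2) := by
        have h3 : (esrc a).1 = 1 := congrArg Prod.fst ha
        exact Prod.ext h3 rfl
      refine ⟨a.2, ?_⟩
      have h3 : ed a.2 = ((β (1, u)).1, e) := by
        refine edge_unique ?_ ?_
        · rw [hsrc, ← h2, ha, h1]
        · rw [htgt, ← h2, ha', β.apply_symm_apply]
      exact congrArg Prod.snd h3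
  have hlen : ∀ d, B.len (ed d).2 = A.len d := fun d => by
    have h1 := tdist_edge (ed d)
    rw [hsrc, htgt, hβ, tdist_edge] at h1
    exact h1.symm
  have hrev : ∀ d, B.rev (ed d).2 = (ed (A.rev d)).2 := fun d => by
    -- The reverse of the lift of `d` at `1` is the translate by `A.hol d` of the lift of `rev d` at
    -- `1`.
    have h1 : erev (ed d) = eact (A.hol d) (ed (A.rev d)) := by
      refine edge_unique ?_ ?_
      · rw [esrc_erev, htgt, esrc_eact, hsrc, ← hact]
        simp [act, etgt, esrc, Graph.tgt]
      · rw [etgt_erev, hsrc, etgt_eact, htgt, ← hact]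
        simp [act, etgt, esrc, A.hol_rev, Graph.tgt_rev]
    exact congrArg Prod.snd h1
  let h : Homothety A B :=
    { onV := Equiv.ofBijective _ hV
      onD := Equiv.ofBijective _ hD
      src_map := hsV
      rev_map := hrev
      ratio := 1
      ratio_pos := one_pos
      len_map := fun d => (hlen d).trans (one_mul _).symm }
  have hpath : ∀ (c : List A.D) (y z : A.TV), A.Joins y c z →
      B.Joins (β y) (c.map h.onD) (β z) := by
    intro c
    induction c with
    | nil =>
      intro y z hc
      rw [Joins.nil_iff.1 hc]
      exact Joins.nil _
    | cons d c ih =>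
      intro y z hc
      obtain ⟨h1, h2⟩ := hc.cons
      refine Joins.append (p := [h.onD d]) ?_ (ih _ _ h2)
      have h3 := joins_edge (eact y.1 (ed d))
      rw [esrc_eact, etgt_eact, hsrc, htgt, ← hact, ← hact, ← esrc_eact, ← etgt_eact] at h3
      have h4 : eact y.1 ((1, d) : A.TE) = (y.1, d) := by simp [eact]
      rw [h4, h1] at h3
      exact h3
  refine ⟨h, ?_⟩
  -- The change of base point is the path in `B` below the geodesic from the base lift of `B` to the
  -- image of that of `A`.
  obtain ⟨p, -, hp⟩ := exists_joins ((1, B.base) : B.TV) (β (1, A.base))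
  refine ⟨p, hp.1, fun w c hc => ?_⟩
  obtain ⟨hc', rfl⟩ := A.represents_iff.1 hc
  have h1 : A.Joins (1, A.base) c (act (A.holPath c) (1, A.base)) := ⟨hc', by simp [act]⟩
  have h2 := hpath c _ _ h1
  rw [hact] at h2
  have h3 : B.Joins (act (A.holPath c) (β (1, A.base))) (B.revPath p)
      (act (A.holPath c) (1, B.base)) :=
    ⟨hp.revPath.1, by
      have := hp.revPath.2
      simp only [act] at this ⊢
      rw [mul_assoc, this]⟩
  have h4 := (hp.append h2).append h3
  refine B.represents_iff.2 ⟨h4.1, ?_⟩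
  have h5 := h4.2
  simpa [act] using h5

/-! ### Bounds for the right hand factor -/

theorem volume_le_of_translationLength_le
    (hl : ∀ w, B.translationLength w ≤ A.translationLength w) : B.volume ≤ A.volume :=
  let ⟨f⟩ := exists_treeMap hl
  f.volume_le

theorem equivalent_of_translationLength_le
    (hl : ∀ w, B.translationLength w ≤ A.translationLength w) (hv : B.volume = A.volume) :
    Equivalent A B := by
  obtain ⟨f⟩ := exists_treeMap hl
  obtain ⟨β, h1, h2⟩ := f.exists_equiv hv
  exact equivalent_of_isometry β h1 h2

theorem translationLength_one (A : MarkedMetricGraph n) : A.translationLength 1 = 0 := by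
  apply le_antisymm
  · have := translationLength_le 1 ((1, A.base) : A.TV)
    rwa [act_one, treeMetric_tdist.self] at this
  · exact le_translationLength 1 fun y => treeMetric_tdist.nonneg _ _

/-- Sending the vertex `(g, v)` of the tree of `A` to `g o` is equivariant and Lipschitz: crossing
an edge `d` moves the image by at most `C`, and every edge has length at least `m`. -/
theorem exists_translationLength_le_mul (A B : MarkedMetricGraph n) :
    ∃ K, ∀ w, B.translationLength w ≤ K * A.translationLength w := by
  let o : B.TV := (1, B.base)
  have T := treeMetric_tdist (A := B)
  obtain ⟨m, hm, hlen⟩ := A.exists_le_len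
  have hC0 : ∀ d, 0 ≤ tdist o (act (A.hol d) o) := fun d => T.nonneg _ _
  let C := ∑ d, tdist o (act (A.hol d) o)
  have hC : ∀ d, tdist o (act (A.hol d) o) ≤ C := fun d =>
    Finset.single_le_sum (fun d _ => hC0 d) (Finset.mem_univ d)
  have hCn : 0 ≤ C := Finset.sum_nonneg fun d _ => hC0 d
  have hpath : ∀ p : List A.D, tdist o (act (A.holPath p) o) ≤ C / m * A.pathLength p := by
    intro p
    induction p with
    | nil => simp [act_one, T.self, pathLength_nil]
    | cons d p ih =>
      have h1 := T.triangle o (act (A.hol d) o) (act (A.holPath (d :: p)) o)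
      rw [holPath_cons, act_mul, tdist_act, ← act_mul, ← holPath_cons] at h1
      have h2 : C ≤ C / m * A.len d := by
        rw [div_mul_eq_mul_div, le_div_iff₀ hm]
        exact mul_le_mul_of_nonneg_left (hlen d) hCn
      rw [pathLength_cons, mul_add]
      linarith [hC d]
  -- The summand one makes the constant positive even if `C = 0`, so it can be divided by.
  refine ⟨C / m + 1, fun w => ?_⟩
  have hpos : 0 < C / m + 1 := by positivity
  rw [← div_le_iff₀' hpos]
  refine le_translationLength w fun y => ?_
  rw [div_le_iff₀' hpos]
  obtain ⟨p, rp, hp⟩ := exists_joins y (act w y)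
  have h1 := translationLength_le w (act y.1 o)
  have h3 : w * y.1 = y.1 * A.holPath p := hp.2.symm
  rw [← act_mul, h3, act_mul, tdist_act] at h1
  rw [hp.tdist_eq rp, add_mul, one_mul]
  linarith [hpath p, A.pathLength_nonneg p]

/-- The ratios of translation lengths are bounded. -/
theorem bddAbove_ratios (A B : MarkedMetricGraph n) : BddAbove (A.ratios B) := by
  obtain ⟨K, hK⟩ := exists_translationLength_le_mul A B
  refine ⟨K, ?_⟩
  rintro r ⟨w, hw, rfl⟩
  rw [div_le_iff₀ (A.translationLength_pos hw)]
  exact hK w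

theorem translationLength_le_mul_rightFactor (A B : MarkedMetricGraph n)
    (w : FreeGroup (Fin n)) :
    B.translationLength w ≤ rightFactor A B * A.translationLength w := by
  by_cases hw : w = 1
  · rw [hw, translationLength_one, translationLength_one, mul_zero]
  · rw [← div_le_iff₀ (A.translationLength_pos hw)]
    exact le_csSup (bddAbove_ratios A B) ⟨w, hw, rfl⟩

theorem translationLength_nonneg (A : MarkedMetricGraph n) (w : FreeGroup (Fin n)) :
    0 ≤ A.translationLength w :=
  le_translationLength w fun _ => treeMetric_tdist.nonneg _ _

theorem one_le_rightFactor (hv : B.volume = A.volume) : 1 ≤ rightFactor A B := by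
  by_contra h
  rw [not_le] at h
  -- Scaled by `c < 1`, `A` still dominates `B` but has smaller volume. The maximum with `1 / 2`
  -- keeps the scale positive without knowing the sign of the supremum.
  let c := max (rightFactor A B) (1 / 2)
  have hc : 0 < c := lt_max_of_lt_right (by norm_num)
  have hc1 : c < 1 := max_lt h (by norm_num)
  have h1 := volume_le_of_translationLength_le (A := A.scale c hc) (B := B) fun w => by
    rw [(Homothety.toScale_compatible A c hc).translationLength]
    exact (translationLength_le_mul_rightFactor A B w).trans
      (mul_le_mul_of_nonneg_right (le_max_left _ _) (A.translationLength_nonneg w))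
  rw [(Homothety.toScale A c hc).volume, hv] at h1
  exact absurd h1 (not_le.2 (mul_lt_of_lt_one_left A.volume_pos hc1))

/-- `Real.sSup_le` also covers an empty set of ratios, whose supremum is zero by convention. -/
theorem rightFactor_self_le (A : MarkedMetricGraph n) : rightFactor A A ≤ 1 :=
  Real.sSup_le (by
    rintro r ⟨w, hw, rfl⟩
    exact (div_self (A.translationLength_pos hw).ne').le) zero_le_one

theorem rightFactor_le_mul (A B C : MarkedMetricGraph n) (h1 : 0 ≤ rightFactor A B)
    (h2 : 0 ≤ rightFactor B C) : rightFactor A C ≤ rightFactor A B * rightFactor B C := by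
  refine Real.sSup_le ?_ (mul_nonneg h1 h2)
  rintro r ⟨w, hw, rfl⟩
  rw [div_le_iff₀ (A.translationLength_pos hw), mul_comm (rightFactor A B), mul_assoc]
  exact (translationLength_le_mul_rightFactor B C w).trans
    (mul_le_mul_of_nonneg_left (translationLength_le_mul_rightFactor A B w) h2)

theorem one_le_rightFactor_normalize (A B : MarkedMetricGraph n) :
    1 ≤ rightFactor A.normalize B.normalize :=
  one_le_rightFactor (by rw [volume_normalize, volume_normalize])

theorem equivalent_of_rightFactor_eq_one
    (h : rightFactor A.normalize B.normalize = 1) : Equivalent A B := by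
  have E := equivalence_equivalent n
  refine E.trans (normalize_equivalent A) (E.trans ?_ (E.symm (normalize_equivalent B)))
  refine equivalent_of_translationLength_le (fun w => ?_)
    (by rw [volume_normalize, volume_normalize])
  have := translationLength_le_mul_rightFactor A.normalize B.normalize w
  rwa [h, one_mul] at this

end MarkedMetricGraph

end OuterSpace

end

theorem mainTheorem6 (n : ℕ) :
    (∀ (A : OuterSpace.MarkedMetricGraph n) (w : FreeGroup (Fin n)), w ≠ 1 →
      0 < A.translationLength w) ∧
    (∀ A B : OuterSpace.MarkedMetricGraph n, BddAbove (A.ratios B)) ∧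
    (∀ A B : OuterSpace.CV n, 0 ≤ OuterSpace.dR A B) ∧
    (∀ A B : OuterSpace.CV n, OuterSpace.dR A B = 0 ↔ A = B) ∧
    (∀ A B C : OuterSpace.CV n,
      OuterSpace.dR A C ≤ OuterSpace.dR A B + OuterSpace.dR B C) := by
  open OuterSpace OuterSpace.MarkedMetricGraph in
  refine ⟨fun A w hw => A.translationLength_pos hw, bddAbove_ratios, ?_, ?_, ?_⟩
  · rintro ⟨A⟩ ⟨B⟩
    exact Real.log_nonneg (one_le_rightFactor_normalize A B)
  · rintro ⟨A⟩ ⟨B⟩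
    constructor
    · intro h
      exact Quotient.sound (s := setoid n) (equivalent_of_rightFactor_eq_one
        (Real.eq_one_of_pos_of_log_eq_zero
          (zero_lt_one.trans_le (one_le_rightFactor_normalize A B)) h))
    · intro h
      rw [← h]
      have h1 := le_antisymm (rightFactor_self_le A.normalize) (one_le_rightFactor_normalize A A)
      change Real.log (rightFactor A.normalize A.normalize) = 0
      rw [h1, Real.log_one]
  · rintro ⟨A⟩ ⟨B⟩ ⟨C⟩
    have h1 := one_le_rightFactor_normalize A B
    have h2 := one_le_rightFactor_normalize B C
    have h3 := one_le_rightFactor_normalize A C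
    change Real.log (rightFactor A.normalize C.normalize) ≤
      Real.log (rightFactor A.normalize B.normalize) +
      Real.log (rightFactor B.normalize C.normalize)
    rw [← Real.log_mul (by linarith) (by linarith)]
    exact Real.log_le_log (by linarith)
      (rightFactor_le_mul _ _ _ (by linarith) (by linarith))
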